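/- Let $0<p\le 1$. In the lazy dispersion process on the complete graph $K_n$ ($n\ge 2$), $M$ particles start at one vertex. At every synchronous step, each particle that shares its vertex with at least one other particle at the beginning of the step independently moves with probability $p$ to a uniformly random neighbour of its vertex, and stays where it is with probability $1-p$; particles that are alone at their vertex do not move. Let $\mathbf T_{\text{Disp}}\in\{0,1,2,\dots\}\cup\{\infty\}$ be the first step at which every vertex holds at most one particle. The following holds both for $K_n$ without loops and for $K_n$ with a loop at every vertex (where the random neighbour is uniform over all $n$ vertices), for $M=(1-\delta)n$ particles; $p$, $\alpha$ and $\delta$ may depend on $n$. (i) There are absolute constants $C,K>0$ such that, for all $n\ge 2$, $0<p\le 1$ and $\alpha>0$, if $\delta=\frac p2+\alpha$ (and $M=(1-\delta)n$ is a non-negative integer), then $$\Pr\bigl(\mathbf T_{\text{Disp}}\le C\,(p\alpha)^{-1}\log n\bigr)\ \ge\ 1-\frac Kn .$$ (ii) There is an absolute constant $c>0$ such that, for all $n\ge 2$, $0<p\le 1$ and $\alpha>0$, if $\delta=\frac p2-\alpha$ (and $M=(1-\delta)n$ is an integer), then $$\Pr\bigl(\mathbf T_{\text{Disp}}\le e^{c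 n p^2\alpha^3}\bigr)\ <\ e^{-c n p^2\alpha^3}.$$ -/

import Mathlib

open MeasureTheory ProbabilityTheory unitInterval

namespace LazyDispersion

noncomputable section

/-- The law of the next position of an unhappy particle located at `v`: with probability `p` the
particle moves to a uniformly random element of the set `nb v` of neighbours of `v`, and with
probability `1 - p` it stays at `v`. -/
def moveLaw {V : Type*} [MeasurableSpace V] (nb : V → Set V) (p : I) (v : V) : Measure V :=
  toNNReal p • uniformOn (nb v) + toNNReal (σ p) • Measure.dirac v

instance {V : Type*} [Fintype V] [MeasurableSpace V] [MeasurableSingletonClass V]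
    (nb : V → Set V) [∀ v, Nonempty (nb v)] (p : I) (v : V) :
    IsProbabilityMeasure (moveLaw nb p v) := by
  have h : IsProbabilityMeasure (uniformOn (nb v)) :=
    isProbabilityMeasure_uniformOn (Set.toFinite _) (Set.nonempty_coe_sort.mp inferInstance)
  unfold moveLaw
  infer_instance

/-- The randomness driving a process with `M` particles on the vertex set `V`: `ω t i v` is the
position that particle `i` takes after step `t + 1` if it is unhappy at vertex `v` at the beginning
of that step. -/
abbrev Moves (M : ℕ) (V : Type*) : Type _ := ℕ → Fin M → V → V

/-- The law of the randomness: all `ω t i v` are independent, `ω t i v` has law `moveLaw nb p v`. -/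
def movesLaw {V : Type*} [Fintype V] [MeasurableSpace V] [MeasurableSingletonClass V]
    (nb : V → Set V) [∀ v, Nonempty (nb v)] (p : I) (M : ℕ) : Measure (Moves M V) :=
  Measure.infinitePi fun _ : ℕ =>
    Measure.pi fun _ : Fin M => Measure.pi fun v : V => moveLaw nb p v

/-- In the configuration `x`, particle `i` is unhappy: it shares its vertex with another one. -/
def Unhappy {M : ℕ} {V : Type*} (x : Fin M → V) (i : Fin M) : Prop := ∃ j, j ≠ i ∧ x j = x i

open Classical in
/-- One synchronous step: unhappy particles follow `r`, happy particles do not move. -/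
def step {M : ℕ} {V : Type*} (x : Fin M → V) (r : Fin M → V → V) : Fin M → V :=
  fun i => if Unhappy x i then r i (x i) else x i

/-- The positions of the particles after `t` steps, all particles starting at the vertex `o`. -/
def position {M : ℕ} {V : Type*} (o : V) (ω : Moves M V) : ℕ → Fin M → V
  | 0 => fun _ => o
  | t + 1 => step (position o ω t) (ω t)

/-- The dispersion time: the first step at which no vertex holds two particles (`⊤` if none). -/
def dispersionTime {M : ℕ} {V : Type*} (o : V) (ω : Moves M V) : ℕ∞ :=
  ⨅ (t : ℕ) (_ : ∀ i, ¬ Unhappy (position o ω t) i), (t : ℕ∞)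

/-- The probability that the lazy dispersion of `M` particles with origin `o` takes at most
`s` steps, `s` a real number. -/
def probTimeLE {V : Type*} [Fintype V] [MeasurableSpace V] [MeasurableSingletonClass V]
    (nb : V → Set V) [∀ v, Nonempty (nb v)] (p : I) (M : ℕ) (o : V) (s : ℝ) : ℝ :=
  (movesLaw nb p M).real {ω | ∃ k : ℕ, dispersionTime o ω = k ∧ (k : ℝ) ≤ s}

/-- The neighbourhoods of the complete graph on `n` vertices, either without loops (the simple
graph `K_n`) or with a loop at every vertex. -/
def completeNbhd (n : ℕ) (loops : Bool) (v : Fin n) : Set (Fin n) :=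
  if loops then Set.univ else (⊤ : SimpleGraph (Fin n)).neighborSet v

instance (n : ℕ) [n.AtLeastTwo] (loops : Bool) (v : Fin n) :
    Nonempty (completeNbhd n loops v) := by
  have : Nontrivial (Fin n) := Fin.nontrivial_iff_two_le.mpr Nat.AtLeastTwo.prop
  obtain ⟨w, hw⟩ := exists_ne v
  exact ⟨w, by cases loops <;> simp [completeNbhd, hw]⟩

end

end LazyDispersion

/-! Part (i) follows the excess `M - |occupiedSites|`, which is 0 when no vertex is crowded and at
least 1 otherwise. In one step a vacant vertex stays vacant only if every unhappy particle misses
it, a crowded vertex empties with probability at most p², and a happy vertex never empties. There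
are at least n(p/2 + α) vacancies. The p/2 pays for the emptied crowded vertices, of which there are
at most half as many as unhappy particles, and α leaves a mean contraction by the factor 1 - pα
(`prodExp_excess_le`). Markov's inequality then gives (i).

Part (ii) compares crowded vertices with a supercritical branching process. Two particles at a
crowded vertex both stay with probability at least (1 - p)². If almost all particles are happy, each
of the two hits a happy vertex, and so makes it crowded, with probability about p(1 - p/2 + α). The
mean number of crowded descendants is thus about (1 - p)² + 2p(1 - p/2 + α) = 1 + 2pα > 1.

Accordingly, X = (1 - α/2)^|crowdedSites| does not increase in mean while at most αn/3 particles are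
unhappy (`prodExp_pow_crowdedSites_le`). With u = np²α³ ≥ 2048, from any other configuration its
mean after one step is at most exp(-u/2²⁴) (`prodExp_pow_crowdedSites_le_of_unhappy`). Adding the
two bounds gives E X ≤ t exp(-u/2²⁴) at time t ≥ 1, and X = 1 once the particles are dispersed. For
smaller u the time horizon is a single step, treated by `prodExp_no_crowded_start_le`.

Only the bounds in `IsLazyKernel` are used, so loops make no difference. -/

namespace LazyDispersion

/-! ### Expectations over independent coordinates -/

section ProductExpectation

/-- The expectation of `F y` when the coordinates `y i` are independent with weights `q i`. -/
def prodExp {ι V : Type*} [Fintype ι] [DecidableEq ι] [Fintype V] (q : ι → V → ℝ)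
    (F : (ι → V) → ℝ) : ℝ := ∑ y, (∏ i, q i (y i)) * F y

variable {ι V : Type*} [Fintype ι] [DecidableEq ι] [Fintype V] {q : ι → V → ℝ}

theorem prodExp_mono (hq : ∀ i v, 0 ≤ q i v) {F G : (ι → V) → ℝ}
    (h : ∀ y, F y ≤ G y) : prodExp q F ≤ prodExp q G :=
  Finset.sum_le_sum fun y _ =>
    mul_le_mul_of_nonneg_left (h y) (Finset.prod_nonneg fun i _ => hq i _)

theorem prodExp_const_mul (c : ℝ) (F : (ι → V) → ℝ) :
    prodExp q (fun y => c * F y) = c * prodExp q F := by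
  simp only [prodExp, Finset.mul_sum]
  exact Finset.sum_congr rfl fun y _ => by ring

theorem prodExp_add (F G : (ι → V) → ℝ) :
    prodExp q (fun y => F y + G y) = prodExp q F + prodExp q G := by
  simp only [prodExp, ← Finset.sum_add_distrib, mul_add]

theorem prodExp_sum {κ : Type*} (s : Finset κ) (F : κ → (ι → V) → ℝ) :
    prodExp q (fun y => ∑ k ∈ s, F k y) = ∑ k ∈ s, prodExp q (F k) := by
  simp only [prodExp, Finset.mul_sum]
  exact Finset.sum_comm

theorem prodExp_prod (f : ι → V → ℝ) :
    prodExp q (fun y => ∏ i, f i (y i)) = ∏ i, ∑ v, q i v * f i v := by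
  simp only [prodExp, ← Finset.prod_mul_distrib]
  exact (Fintype.prod_sum fun i v => q i v * f i v).symm

theorem prodExp_const (h1 : ∀ i, ∑ v, q i v = 1) (c : ℝ) : prodExp q (fun _ => c) = c := by
  have := prodExp_prod (q := q) (fun _ _ => (1 : ℝ))
  simp only [Finset.prod_const_one, mul_one, h1] at this
  simpa [this] using prodExp_const_mul (q := q) c (fun _ => (1 : ℝ))

/-- Integrating out one coordinate. -/
theorem prodExp_update (h1 : ∀ i, ∑ v, q i v = 1) (i : ι) (F : (ι → V) → ℝ) :
    prodExp q F = prodExp q (fun y => ∑ v, q i v * F (Function.update y i v)) := by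
  -- Exchanging `y i` with a fresh independent copy `v` is an involution that preserves the joint
  -- weight.
  let e : (ι → V) × V ≃ (ι → V) × V :=
    { toFun := fun a => (Function.update a.1 i a.2, a.1 i)
      invFun := fun a => (Function.update a.1 i a.2, a.1 i)
      left_inv := fun a => by simp
      right_inv := fun a => by simp }
  have hw : ∀ (y : ι → V) (v : V), (∏ j, q j (Function.update y i v j)) * q i (y i)
      = (∏ j, q j (y j)) * q i v := by
    intro y v
    rw [← Finset.mul_prod_erase _ _ (Finset.mem_univ i),
      ← Finset.mul_prod_erase Finset.univ (fun j => q j (y j)) (Finset.mem_univ i),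
      Finset.prod_congr rfl (g := fun j => q j (y j)) fun j hj => by
        rw [Function.update_of_ne (Finset.ne_of_mem_erase hj)]]
    simp only [Function.update_self]
    ring
  calc prodExp q F = ∑ a : (ι → V) × V, (∏ j, q j (a.1 j)) * q i a.2 * F a.1 := by
        rw [Fintype.sum_prod_type]
        refine Finset.sum_congr rfl fun y _ => ?_
        simp only
        rw [← Finset.sum_mul, ← Finset.mul_sum, h1, mul_one]
    _ = ∑ a : (ι → V) × V, (∏ j, q j (a.1 j)) * q i a.2 * F (Function.update a.1 i a.2) := by
        rw [← Equiv.sum_comp e]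
        refine Finset.sum_congr rfl fun a _ => ?_
        change (∏ j, q j (Function.update a.1 i a.2 j)) * q i (a.1 i) *
          F (Function.update a.1 i a.2) = _
        rw [hw]
    _ = _ := by
        rw [Fintype.sum_prod_type]
        refine Finset.sum_congr rfl fun y _ => ?_
        simp only [Finset.mul_sum]
        exact Finset.sum_congr rfl fun v _ => by ring

variable [DecidableEq V]

theorem sum_mul_one_sub_indicator {r : V → ℝ} (h1 : ∑ v, r v = 1) (A : Finset V) (b : ℝ) :
    ∑ v, r v * (1 - if v ∈ A then b else 0) = 1 - b * ∑ v ∈ A, r v := by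
  simp only [mul_sub, mul_one, Finset.sum_sub_distrib, h1, mul_ite, mul_zero]
  rw [Finset.sum_ite_mem, Finset.univ_inter, Finset.mul_sum]
  exact congrArg _ (Finset.sum_congr rfl fun v _ => mul_comm _ _)

theorem card_inter_insert {V : Type*} [DecidableEq V] (T Y : Finset V) (v : V) :
    (T ∩ insert v Y).card = (T ∩ Y).card + if v ∈ T \ Y then 1 else 0 := by
  by_cases hT : v ∈ T <;> by_cases hY : v ∈ Y
  · simp [hY]
  · rw [Finset.inter_insert_of_mem hT, Finset.card_insert_of_notMem (by simp [hY])]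
    simp [hT, hY]
  · simp [hY]
  · rw [Finset.inter_insert_of_notMem hT]
    simp [hT]

theorem image_update_of_notMem {ι V : Type*} [DecidableEq ι] [DecidableEq V] (s : Finset ι)
    (y : ι → V) {i : ι} (hi : i ∉ s) (v : V) :
    s.image (Function.update y i v) = s.image y :=
  Finset.image_congr fun j hj =>
    Function.update_of_ne (fun h : j = i => hi (h ▸ Finset.mem_coe.mp hj)) _ _

theorem pow_one_sub_ite (b : ℝ) (P : Prop) [Decidable P] :
    (1 - b) ^ (if P then 1 else 0) = 1 - if P then b else 0 := by
  split_ifs <;> simp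

/-- If the coordinates in `s` hit each site of `T` with probability at least `z`, the number of
sites of `T` hit by them is unlikely to be small. -/
theorem prodExp_pow_card_hits_le (hq : ∀ i v, 0 ≤ q i v) (h1 : ∀ i, ∑ v, q i v = 1)
    {b z : ℝ} (hb0 : 0 ≤ b) (hb1 : b ≤ 1) (hz : 0 ≤ z) (s : Finset ι) (T : (ι → V) → Finset V)
    (hT : ∀ i ∈ s, ∀ y v, T (Function.update y i v) = T y)
    (hmove : ∀ i ∈ s, ∀ y, ∀ v ∈ T y, z ≤ q i v) :
    prodExp q (fun y => (1 - b) ^ (T y ∩ s.image y).card) ≤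
      prodExp q (fun y => Real.exp (-(b * z * s.card * ((T y).card - s.card)))) := by
  -- The coordinates are integrated out one at a time. The weight `G` collects the exponential
  -- factors already gained; it must not depend on the coordinates in `s`.
  have key : ∀ t : Finset ι, t ⊆ s → ∀ G : (ι → V) → ℝ, (∀ y, 0 ≤ G y) →
      (∀ i ∈ s, ∀ y v, G (Function.update y i v) = G y) →
      prodExp q (fun y => G y * (1 - b) ^ (T y ∩ t.image y).card) ≤
      prodExp q (fun y => G y * Real.exp (-(b * z * t.card * ((T y).card - s.card)))) := by
    intro t
    induction t using Finset.induction_on with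
    | empty => intro _ G _ _; simp
    | insert i t hi ih =>
      intro hts G hG hGu
      have his : i ∈ s := hts (Finset.mem_insert_self i t)
      have htcard : (t.card : ℝ) ≤ s.card := by
        exact_mod_cast Finset.card_le_card ((Finset.subset_insert i t).trans hts)
      have hinner : ∀ y, ∑ v, q i v * (G (Function.update y i v) *
          (1 - b) ^ (T (Function.update y i v) ∩
            (insert i t).image (Function.update y i v)).card) ≤
          (G y * Real.exp (-(b * z * ((T y).card - s.card)))) *
            (1 - b) ^ (T y ∩ t.image y).card := by
        intro y
        have e1 : ∀ v, q i v * (G (Function.update y i v) *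
          (1 - b) ^ (T (Function.update y i v) ∩
            (insert i t).image (Function.update y i v)).card) =
            (G y * (1 - b) ^ (T y ∩ t.image y).card) *
              (q i v * (1 - if v ∈ T y \ t.image y then b else 0)) := by
          intro v
          rw [hGu i his, hT i his, Finset.image_insert, Function.update_self,
            image_update_of_notMem t y hi, card_inter_insert, pow_add, pow_one_sub_ite]
          ring
        rw [Finset.sum_congr rfl fun v _ => e1 v, ← Finset.mul_sum,
          sum_mul_one_sub_indicator (h1 i)]
        -- At most `t.card ≤ s.card` sites of `T y` were hit before, so the rest are still available
        -- to coordinate `i`.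
        have e2 : z * ((T y).card - s.card) ≤ ∑ v ∈ T y \ t.image y, q i v := by
          calc z * ((T y).card - s.card) ≤ ((T y \ t.image y).card : ℝ) * z := by
                rw [mul_comm]
                refine mul_le_mul_of_nonneg_right ?_ hz
                have a1 := Finset.le_card_sdiff (t.image y) (T y)
                have a2 : (t.image y).card ≤ t.card := Finset.card_image_le
                have a3 : (T y).card ≤ (T y \ t.image y).card + t.card := by omega
                have a4 : ((T y).card : ℝ) ≤ (T y \ t.image y).card + t.card := by
                  exact_mod_cast a3
                linarith
            _ ≤ _ := by
                rw [← nsmul_eq_mul]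
                exact Finset.card_nsmul_le_sum _ _ _ fun v hv =>
                  hmove i his y v (Finset.mem_sdiff.mp hv).1
        have e3 : 1 - b * ∑ v ∈ T y \ t.image y, q i v ≤
            Real.exp (-(b * z * ((T y).card - s.card))) := by
          have := Real.add_one_le_exp (-(b * z * ((T y).card - s.card)))
          nlinarith [mul_le_mul_of_nonneg_left e2 hb0]
        calc _ ≤ (G y * (1 - b) ^ (T y ∩ t.image y).card) *
              Real.exp (-(b * z * ((T y).card - s.card))) :=
              mul_le_mul_of_nonneg_left e3
                (mul_nonneg (hG y) (pow_nonneg (by linarith) _))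
          _ = _ := by ring
      rw [prodExp_update h1 i]
      refine (prodExp_mono hq hinner).trans ?_
      refine (ih ((Finset.subset_insert i t).trans hts) _
        (fun y => mul_nonneg (hG y) (Real.exp_pos _).le) ?_).trans (le_of_eq ?_)
      · intro j hj y v
        simp only [hGu j hj, hT j hj]
      · congr 1
        funext y
        rw [mul_assoc, ← Real.exp_add, Finset.card_insert_of_notMem hi]
        congr 2
        push_cast
        ring
  have := key s subset_rfl (fun _ => 1) (fun _ => zero_le_one) (fun _ _ _ _ => rfl)
  simpa using this

/-- Two independent particles started at `v`: the chance that both stay competes with the sites of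
`A` that they hit. -/
theorem sum_pair_le {r : V → ℝ} (hr : ∀ v, 0 ≤ r v) (h1 : ∑ v, r v = 1) {b ρ : ℝ}
    (hb0 : 0 ≤ b) (hb1 : b ≤ 1) (v : V) (A : Finset V) (hvA : v ∉ A)
    (hA : ∀ u, ρ ≤ ∑ w ∈ A.erase u, r w)
    (hgain : 1 + b * ρ ^ 2 ≤ r v ^ 2 + 2 * ρ) :
    ∑ u, r u * ∑ w, r w * ((1 - if u = v ∧ w = v then b else 0) *
      ((1 - if u ∈ A then b else 0) * (1 - if w ∈ A.erase u then b else 0))) ≤ 1 - b := by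
  have hrv : r v ≤ 1 := h1 ▸ Finset.single_le_sum (fun w _ => hr w) (Finset.mem_univ v)
  have hle : ∀ B : Finset V, ∑ w ∈ B, r w ≤ 1 := fun B =>
    h1 ▸ Finset.sum_le_sum_of_subset_of_nonneg (Finset.subset_univ B) fun w _ _ => hr w
  have hρ1 : ρ ≤ 1 := (hA v).trans (hle _)
  have hρA : ρ ≤ ∑ w ∈ A, r w :=
    (hA v).trans (Finset.sum_le_sum_of_subset_of_nonneg (Finset.erase_subset _ _)
      fun w _ _ => hr w)
  have hinner : ∀ u, ∑ w, r w * ((1 - if u = v ∧ w = v then b else 0) *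
      ((1 - if u ∈ A then b else 0) * (1 - if w ∈ A.erase u then b else 0))) ≤
      (1 - b * ρ) * (1 - if u ∈ A then b else 0) - (if u = v then b * r v else 0) := by
    intro u
    by_cases huv : u = v
    · subst huv
      -- As `v ∉ A`, staying at `v` and hitting `A` exclude each other, so the two factors merge
      -- into one indicator.
      have e : ∀ w, r w * ((1 - if u = u ∧ w = u then b else 0) *
          ((1 - if u ∈ A then b else 0) * (1 - if w ∈ A.erase u then b else 0))) =
          r w * (1 - if w ∈ insert u (A.erase u) then b else 0) := by
        intro w
        by_cases hw : w = u
        · subst hw; simp [hvA]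
        · simp [hw, hvA]
      rw [Finset.sum_congr rfl fun w _ => e w, sum_mul_one_sub_indicator h1,
        Finset.sum_insert (by simp)]
      have := mul_le_mul_of_nonneg_left (hA u) hb0
      simp only [hvA, if_false, if_true, sub_zero, mul_one]
      linarith
    · have e : ∀ w, r w * ((1 - if u = v ∧ w = v then b else 0) *
          ((1 - if u ∈ A then b else 0) * (1 - if w ∈ A.erase u then b else 0))) =
          (1 - if u ∈ A then b else 0) * (r w * (1 - if w ∈ A.erase u then b else 0)) := by
        intro w
        simp only [huv, false_and, if_false, sub_zero]
        ring
      rw [Finset.sum_congr rfl fun w _ => e w, ← Finset.mul_sum, sum_mul_one_sub_indicator h1]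
      simp only [huv, if_false, sub_zero]
      rw [mul_comm]
      refine mul_le_mul_of_nonneg_right ?_ (by split_ifs <;> linarith)
      have := mul_le_mul_of_nonneg_left (hA u) hb0
      linarith
  calc _ ≤ ∑ u, r u * ((1 - b * ρ) * (1 - if u ∈ A then b else 0) -
          (if u = v then b * r v else 0)) :=
        Finset.sum_le_sum fun u _ => mul_le_mul_of_nonneg_left (hinner u) (hr u)
    _ = (1 - b * ρ) * (1 - b * ∑ w ∈ A, r w) - b * r v ^ 2 := by
        rw [← sum_mul_one_sub_indicator h1 A b, Finset.mul_sum]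
        simp only [mul_sub, Finset.sum_sub_distrib, mul_ite, mul_zero, Finset.sum_ite_eq',
          Finset.mem_univ, if_true]
        congr 1
        · rw [← Finset.sum_sub_distrib, ← Finset.sum_sub_distrib]
          exact Finset.sum_congr rfl fun u _ => by split_ifs <;> ring
        · ring
    _ ≤ (1 - b * ρ) * (1 - b * ρ) - b * r v ^ 2 := by
        have hbρ : b * ρ ≤ 1 := by nlinarith
        have := mul_le_mul_of_nonneg_left hρA hb0
        nlinarith
    -- After expanding the square, this is `hgain` multiplied by `b`.
    _ ≤ 1 - b := by nlinarith [mul_le_mul_of_nonneg_left hgain hb0]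

end ProductExpectation

/-! ### Happy, crowded and occupied vertices of a configuration -/

section Configurations

variable {M : ℕ} {V : Type*} [Fintype V] [DecidableEq V]

/-- The vertices holding at least two particles. -/
def crowdedSites (x : Fin M → V) : Finset V :=
  Finset.univ.filter fun v => ∃ i j, i ≠ j ∧ x i = v ∧ x j = v

/-- The vertices holding at least one particle. -/
def occupiedSites {M : ℕ} {V : Type*} [DecidableEq V] (x : Fin M → V) : Finset V :=
  Finset.univ.image x

/-- The set of unhappy particles. -/
def unhappySet {M : ℕ} {V : Type*} [DecidableEq V] (x : Fin M → V) : Finset (Fin M) :=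
  Finset.univ.filter fun i => ∃ j, j ≠ i ∧ x j = x i

/-- The vertices holding exactly one particle. -/
def happySites (x : Fin M → V) : Finset V := occupiedSites x \ crowdedSites x

open Classical in
/-- The configuration after a step in which `y` lists the moves of the unhappy particles. -/
noncomputable def stepTo {M : ℕ} {V : Type*} (x y : Fin M → V) : Fin M → V :=
  fun i => if Unhappy x i then y i else x i

theorem step_eq_stepTo {M : ℕ} {V : Type*} (x : Fin M → V) (r : Fin M → V → V) :
    step x r = stepTo x fun i => r i (x i) := rfl

theorem mem_crowdedSites {x : Fin M → V} {v : V} :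
    v ∈ crowdedSites x ↔ ∃ i j, i ≠ j ∧ x i = v ∧ x j = v := by simp [crowdedSites]

theorem mem_unhappySet {M : ℕ} {V : Type*} [DecidableEq V] {x : Fin M → V} {i : Fin M} :
    i ∈ unhappySet x ↔ Unhappy x i := by
  simp [unhappySet, Unhappy]

theorem mem_unhappySet_iff {x : Fin M → V} {i : Fin M} :
    i ∈ unhappySet x ↔ x i ∈ crowdedSites x := by
  rw [mem_unhappySet, mem_crowdedSites]
  constructor
  · rintro ⟨j, hj, h⟩
    exact ⟨j, i, hj, h, rfl⟩
  · rintro ⟨j, k, hjk, hj, hk⟩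
    by_cases h : j = i
    · exact ⟨k, fun hki => hjk (h.trans hki.symm), hk⟩
    · exact ⟨j, h, hj⟩

theorem crowdedSites_subset_occupiedSites (x : Fin M → V) :
    crowdedSites x ⊆ occupiedSites x := by
  intro v hv
  obtain ⟨i, -, -, hi, -⟩ := mem_crowdedSites.mp hv
  exact Finset.mem_image.mpr ⟨i, Finset.mem_univ i, hi⟩

/-- Happy particles sit at distinct vertices, so happy vertices count them. -/
theorem card_happySites_add (x : Fin M → V) :
    (happySites x).card + (unhappySet x).card = M := by
  have h : happySites x = (Finset.univ \ unhappySet x).image x := by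
    ext v
    simp only [happySites, occupiedSites, Finset.mem_sdiff, Finset.mem_image, Finset.mem_univ,
      true_and, mem_unhappySet_iff]
    constructor
    · rintro ⟨⟨i, rfl⟩, hv⟩
      exact ⟨i, hv, rfl⟩
    · rintro ⟨i, hv, rfl⟩
      exact ⟨⟨i, rfl⟩, hv⟩
  rw [h, Finset.card_image_of_injOn, Finset.card_sdiff_add_card_eq_card (Finset.subset_univ _),
    Finset.card_univ, Fintype.card_fin]
  intro i hi j hj hij
  by_contra hne
  have : i ∉ unhappySet x := by simpa using hi
  exact this (mem_unhappySet.mpr ⟨j, fun h => hne h.symm, hij.symm⟩)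

theorem card_happySites_add_crowdedSites (x : Fin M → V) :
    (happySites x).card + (crowdedSites x).card = (occupiedSites x).card :=
  Finset.card_sdiff_add_card_eq_card (crowdedSites_subset_occupiedSites x)

theorem two_mul_card_crowdedSites_le (x : Fin M → V) :
    2 * (crowdedSites x).card ≤ (unhappySet x).card := by
  have hmaps : ∀ i ∈ unhappySet x, x i ∈ crowdedSites x := fun i => mem_unhappySet_iff.mp
  rw [Finset.card_eq_sum_card_fiberwise hmaps, mul_comm, ← smul_eq_mul]
  refine Finset.card_nsmul_le_sum _ _ _ fun v hv => ?_
  obtain ⟨i, j, hij, hi, hj⟩ := mem_crowdedSites.mp hv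
  refine Finset.one_lt_card.mpr ⟨i, ?_, j, ?_, hij⟩
  · exact Finset.mem_filter.mpr ⟨mem_unhappySet_iff.mpr (hi ▸ hv), hi⟩
  · exact Finset.mem_filter.mpr ⟨mem_unhappySet_iff.mpr (hj ▸ hv), hj⟩

theorem card_occupiedSites_le {M : ℕ} {V : Type*} [DecidableEq V] (x : Fin M → V) :
    (occupiedSites x).card ≤ M := by
  simpa [occupiedSites] using Finset.card_image_le (s := Finset.univ) (f := x)

theorem crowdedSites_eq_empty_iff {x : Fin M → V} :
    crowdedSites x = ∅ ↔ ∀ i, ¬ Unhappy x i := by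
  constructor
  · intro h i hi
    have := mem_unhappySet_iff.mp (mem_unhappySet.mpr hi)
    simp [h] at this
  · intro h
    refine Finset.eq_empty_of_forall_notMem fun v hv => ?_
    obtain ⟨i, j, hij, hi, hj⟩ := mem_crowdedSites.mp hv
    exact h j ⟨i, hij, hi.trans hj.symm⟩

theorem stepTo_of_mem {M : ℕ} {V : Type*} [DecidableEq V] {x : Fin M → V} {i : Fin M}
    (h : i ∈ unhappySet x) (y : Fin M → V) :
    stepTo x y i = y i := by
  have := mem_unhappySet.mp h
  simp [stepTo, this]

theorem stepTo_of_notMem {M : ℕ} {V : Type*} [DecidableEq V] {x : Fin M → V} {i : Fin M}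
    (h : i ∉ unhappySet x) (y : Fin M → V) :
    stepTo x y i = x i := by
  rw [mem_unhappySet] at h
  simp [stepTo, h]

theorem mem_crowdedSites_stepTo_of_pair {x y : Fin M → V} {i j : Fin M} {v : V} (hij : i ≠ j)
    (hi : i ∈ unhappySet x) (hj : j ∈ unhappySet x) (hyi : y i = v) (hyj : y j = v) :
    v ∈ crowdedSites (stepTo x y) :=
  mem_crowdedSites.mpr
    ⟨i, j, hij, (stepTo_of_mem hi y).trans hyi, (stepTo_of_mem hj y).trans hyj⟩

theorem mem_crowdedSites_stepTo_of_happy {x y : Fin M → V} {i : Fin M} {v : V}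
    (hv : v ∈ happySites x) (hi : i ∈ unhappySet x) (hyi : y i = v) :
    v ∈ crowdedSites (stepTo x y) := by
  obtain ⟨ho, hc⟩ := Finset.mem_sdiff.mp hv
  obtain ⟨h, -, hh⟩ := Finset.mem_image.mp ho
  have hh' : h ∉ unhappySet x := fun hm => hc (hh ▸ mem_unhappySet_iff.mp hm)
  exact mem_crowdedSites.mpr ⟨i, h, fun e => hh' (e ▸ hi), (stepTo_of_mem hi y).trans hyi,
    (stepTo_of_notMem hh' y).trans hh⟩

theorem stepTo_of_crowdedSites_eq_empty {x : Fin M → V} (h : crowdedSites x = ∅)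
    (y : Fin M → V) : stepTo x y = x := by
  funext i
  refine stepTo_of_notMem (fun hi => ?_) y
  have := mem_unhappySet_iff.mp hi
  simp [h] at this

end Configurations

/-! ### One step of chosen pairs at crowded vertices -/

section CrowdedPairs

variable {ι V : Type*} [Fintype ι] [DecidableEq ι] [Fintype V] [DecidableEq V]

/-- One pair of particles is singled out at each vertex of `C`. Integrating the pairs out one by
one, each contributes a factor at most `1 - b` by `sum_pair_le`, provided only newly hit sites of
`T` are credited to it. -/
theorem prodExp_pow_pairs_le {κ : V → V → ℝ} (hκ : ∀ v w, 0 ≤ κ v w) (h1 : ∀ v, ∑ w, κ v w = 1)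
    {b z ρ : ℝ} (hb0 : 0 ≤ b) (hb1 : b ≤ 1) (hz : 0 ≤ z) (x : ι → V)
    (C T : Finset V) (hCT : Disjoint C T) (f g : V → ι)
    (hfg : ∀ v ∈ C, f v ≠ g v ∧ x (f v) = v ∧ x (g v) = v)
    (hmove : ∀ v ∈ C, ∀ w ∈ T, z ≤ κ v w) (hρ : ρ ≤ z * (T.card - 2 * C.card))
    (hgain : ∀ v ∈ C, 1 + b * ρ ^ 2 ≤ κ v v ^ 2 + 2 * ρ) :
    prodExp (fun i => κ (x i)) (fun y => (1 - b) ^ ((C.filter fun v => y (f v) = v ∧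
      y (g v) = v).card + (T ∩ (C.image (fun v => y (f v)) ∪ C.image fun v => y (g v))).card)) ≤
      (1 - b) ^ C.card := by
  have hq : ∀ i v, 0 ≤ κ (x i) v := fun i => hκ (x i)
  have hq1 : ∀ i, ∑ v, κ (x i) v = 1 := fun i => h1 (x i)
  suffices key : ∀ s : Finset V, s ⊆ C →
      prodExp (fun i => κ (x i)) (fun y => (1 - b) ^ ((s.filter fun v => y (f v) = v ∧
        y (g v) = v).card +
          (T ∩ (s.image (fun v => y (f v)) ∪ s.image fun v => y (g v))).card)) ≤
      (1 - b) ^ s.card from key C subset_rfl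
  intro s
  induction s using Finset.induction_on with
  | empty => intro _; simp [prodExp_const hq1]
  | insert v s hv ih =>
    intro hs
    have hvC : v ∈ C := hs (Finset.mem_insert_self v s)
    have hsC : s ⊆ C := (Finset.subset_insert v s).trans hs
    have hcard : (s.card : ℝ) + 1 ≤ C.card := by
      have := Finset.card_le_card hs
      rw [Finset.card_insert_of_notMem hv] at this
      exact_mod_cast this
    obtain ⟨hne, hxf, hxg⟩ := hfg v hvC
    have hupd : ∀ (y : ι → V) (u w : V), ∀ i, x i ≠ v →
        Function.update (Function.update y (f v) u) (g v) w i = y i := by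
      intro y u w i hi
      rw [Function.update_of_ne (fun e : i = g v => hi (e ▸ hxg)),
        Function.update_of_ne (fun e : i = f v => hi (e ▸ hxf))]
    -- Both particles of the pair at `v` are redrawn; the other pairs sit at other vertices and are
    -- unaffected.
    rw [prodExp_update hq1 (g v), prodExp_update hq1 (f v), hxf, hxg]
    refine (prodExp_mono hq (G := fun y => (1 - b) * (1 - b) ^ ((s.filter fun v => y (f v) = v ∧
        y (g v) = v).card +
          (T ∩ (s.image (fun v => y (f v)) ∪ s.image fun v => y (g v))).card))
        fun y => ?_).trans ?_
    · set Y := s.image (fun v => y (f v)) ∪ s.image fun v => y (g v) with hY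
      set N := (s.filter fun v => y (f v) = v ∧ y (g v) = v).card + (T ∩ Y).card with hN
      have e : ∀ u w, (1 - b) ^ (((insert v s).filter fun v' =>
          Function.update (Function.update y (f v) u) (g v) w (f v') = v' ∧
          Function.update (Function.update y (f v) u) (g v) w (g v') = v').card +
          (T ∩ ((insert v s).image
            (fun v' => Function.update (Function.update y (f v) u) (g v) w (f v')) ∪
            (insert v s).image
            (fun v' => Function.update (Function.update y (f v) u) (g v) w (g v')))).card) =
          (1 - b) ^ N * ((1 - if u = v ∧ w = v then b else 0) *
      ((1 - if u ∈ T \ Y then b else 0) * (1 - if w ∈ (T \ Y).erase u then b else 0))) := by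
        intro u w
        have ha : ∀ v' ∈ s, x (f v') ≠ v ∧ x (g v') ≠ v := fun v' hv' => by
          rw [(hfg v' (hsC hv')).2.1, (hfg v' (hsC hv')).2.2]
          exact ⟨fun h => hv (h ▸ hv'), fun h => hv (h ▸ hv')⟩
        have i1 : s.image
            (fun v' => Function.update (Function.update y (f v) u) (g v) w (f v')) =
            s.image (fun v => y (f v)) :=
          Finset.image_congr fun v' hv' => hupd y u w _ (ha v' hv').1
        have i2 : s.image
            (fun v' => Function.update (Function.update y (f v) u) (g v) w (g v')) =
            s.image (fun v => y (g v)) :=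
          Finset.image_congr fun v' hv' => hupd y u w _ (ha v' hv').2
        have i3 : (s.filter fun v' =>
            Function.update (Function.update y (f v) u) (g v) w (f v') = v' ∧
            Function.update (Function.update y (f v) u) (g v) w (g v') = v') =
            s.filter fun v => y (f v) = v ∧ y (g v) = v :=
          Finset.filter_congr fun v' hv' => by
            rw [hupd y u w _ (ha v' hv').1, hupd y u w _ (ha v' hv').2]
        have i4 : ((insert v s).filter fun v' =>
            Function.update (Function.update y (f v) u) (g v) w (f v') = v' ∧
            Function.update (Function.update y (f v) u) (g v) w (g v') = v').card =
            (s.filter fun v => y (f v) = v ∧ y (g v) = v).card +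
              if u = v ∧ w = v then 1 else 0 := by
          rw [Finset.filter_insert, Function.update_self, Function.update_of_ne hne,
            Function.update_self, i3]
          split_ifs
          · rw [Finset.card_insert_of_notMem (by simp [hv])]
          · rfl
        rw [i4, Finset.image_insert, Finset.image_insert, i1, i2, Function.update_self,
          Function.update_of_ne hne, Function.update_self, Finset.insert_union,
          Finset.union_insert, ← hY, Finset.insert_comm, card_inter_insert, card_inter_insert,
          Finset.sdiff_insert, ← pow_one_sub_ite, ← pow_one_sub_ite, ← pow_one_sub_ite, hN]
        ring
      have hYcard : Y.card ≤ 2 * s.card := by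
        have a1 := Finset.card_union_le (s.image fun v => y (f v)) (s.image fun v => y (g v))
        have a2 : (s.image fun v => y (f v)).card ≤ s.card := Finset.card_image_le
        have a3 : (s.image fun v => y (g v)).card ≤ s.card := Finset.card_image_le
        rw [← hY] at a1
        omega
      -- Earlier pairs use up at most `2 * s.card` sites and the first particle of this pair one
      -- more, which is less than `2 * C.card`.
      have hA : ∀ u, ρ ≤ ∑ w ∈ (T \ Y).erase u, κ v w := by
        intro u
        calc ρ ≤ z * (T.card - 2 * C.card) := hρ
          _ ≤ z * ((T \ Y).erase u).card := by
              refine mul_le_mul_of_nonneg_left ?_ hz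
              have a1 := Finset.pred_card_le_card_erase (s := T \ Y) (a := u)
              have a2 := Finset.le_card_sdiff Y T
              have a3 : T.card ≤ ((T \ Y).erase u).card + 2 * s.card + 1 := by omega
              have a4 : (T.card : ℝ) ≤ ((T \ Y).erase u).card + 2 * s.card + 1 := by
                exact_mod_cast a3
              linarith
          _ ≤ _ := by
              rw [mul_comm, ← nsmul_eq_mul]
              exact Finset.card_nsmul_le_sum _ _ _ fun w hw => hmove v hvC w
                (Finset.mem_sdiff.mp (Finset.mem_of_mem_erase hw)).1
      have hvA : v ∉ T \ Y := fun h =>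
        Finset.disjoint_left.mp hCT hvC (Finset.mem_sdiff.mp h).1
      have hmain := sum_pair_le (hκ v) (h1 v) hb0 hb1 v (T \ Y) hvA hA (hgain v hvC)
      calc _ = (1 - b) ^ N * ∑ u, κ v u * ∑ w, κ v w * ((1 - if u = v ∧ w = v then b else 0) *
            ((1 - if u ∈ T \ Y then b else 0) *
              (1 - if w ∈ (T \ Y).erase u then b else 0))) := by
            rw [Finset.mul_sum]
            refine Finset.sum_congr rfl fun u _ => ?_
            simp only [Finset.mul_sum]
            refine Finset.sum_congr rfl fun w _ => ?_
            rw [e u w]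
            ring
        _ ≤ (1 - b) ^ N * (1 - b) :=
            mul_le_mul_of_nonneg_left hmain (pow_nonneg (by linarith) _)
        _ = _ := mul_comm _ _
    · rw [prodExp_const_mul, Finset.card_insert_of_notMem hv, pow_succ']
      exact mul_le_mul_of_nonneg_left (ih hsC) (by linarith)

end CrowdedPairs

/-- `κ v w` is the probability that an unhappy particle at `v` goes to `w`: it stays with
probability at least `1 - p`, and reaches every other vertex with probability at least `p / |V|`. -/
structure IsLazyKernel {V : Type*} [Fintype V] (κ : V → V → ℝ) (p : ℝ) : Prop where
  nonneg : ∀ v w, 0 ≤ κ v w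
  sum_eq_one : ∀ v, ∑ w, κ v w = 1
  stay : ∀ v, 1 - p ≤ κ v v
  move : ∀ v w, v ≠ w → p / Fintype.card V ≤ κ v w

theorem IsLazyKernel.le_one {V : Type*} [Fintype V] {κ : V → V → ℝ} {p : ℝ}
    (h : IsLazyKernel κ p) (v w : V) : κ v w ≤ 1 :=
  h.sum_eq_one v ▸ Finset.single_le_sum (fun u _ => h.nonneg v u) (Finset.mem_univ w)

/-! ### Mean decrease of the excess -/

section Drift

theorem one_sub_pow_le {z : ℝ} (h0 : 0 ≤ z) (h1 : z ≤ 1) (k : ℕ) :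
    (1 - z) ^ k ≤ 1 - k * z + k * (k - 1) / 2 * z ^ 2 := by
  induction k with
  | zero => simp
  | succ k ih =>
    have hk : (0 : ℝ) ≤ k * (k - 1) := by
      rcases Nat.eq_zero_or_pos k with h | h
      · simp [h]
      · have : (1 : ℝ) ≤ k := by exact_mod_cast h
        nlinarith
    rw [pow_succ]
    push_cast
    have := mul_le_mul_of_nonneg_right ih (sub_nonneg.mpr h1)
    have hz3 : 0 ≤ k * (k - 1) / 2 * z ^ 3 := by positivity
    nlinarith

variable {M : ℕ} {V : Type*} [Fintype V] [DecidableEq V] {κ : V → V → ℝ} {p : ℝ}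

/-- A vertex left vacant is missed by every particle of `s`. The freedom in `s` allows two particles
for a crowded vertex and all unhappy ones for a vacant vertex. -/
theorem prodExp_vacant_le (hκ : IsLazyKernel κ p) (x : Fin M → V) (s : Finset (Fin M))
    (hs : s ⊆ unhappySet x) (v : V) :
    prodExp (fun i => κ (x i)) (fun y => if v ∈ occupiedSites (stepTo x y) then 0 else 1) ≤
      ∏ i ∈ s, (1 - κ (x i) v) := by
  have h1 : ∀ i, ∑ w, κ (x i) w = 1 := fun i => hκ.sum_eq_one _
  calc _ ≤ prodExp (fun i => κ (x i))
        (fun y => ∏ i, if i ∈ s then (1 - if y i ∈ ({v} : Finset V) then (1 : ℝ) else 0)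
          else 1) := by
        refine prodExp_mono (fun i => hκ.nonneg (x i)) fun y => ?_
        split_ifs with h
        · refine Finset.prod_nonneg fun i _ => ?_
          split_ifs <;> norm_num
        · refine le_of_eq (Eq.symm (Finset.prod_eq_one fun i _ => ?_))
          split_ifs with hi hy
          · refine absurd ?_ h
            refine Finset.mem_image.mpr ⟨i, Finset.mem_univ i, ?_⟩
            rw [stepTo_of_mem (hs hi), Finset.mem_singleton.mp hy]
          · simp
          · rfl
    _ = ∏ i, ∑ w, κ (x i) w *
          (if i ∈ s then (1 - if w ∈ ({v} : Finset V) then (1 : ℝ) else 0) else 1) :=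
        prodExp_prod (q := fun i => κ (x i)) fun i w =>
          if i ∈ s then (1 - if w ∈ ({v} : Finset V) then (1 : ℝ) else 0) else 1
    _ = ∏ i, if i ∈ s then (1 - κ (x i) v) else 1 := by
        refine Finset.prod_congr rfl fun i _ => ?_
        split_ifs
        · rw [sum_mul_one_sub_indicator (h1 i)]
          simp
        · simp [h1 i]
    _ = _ := by rw [Finset.prod_ite_mem, Finset.univ_inter]

theorem prodExp_card_vacant_le (hκ : IsLazyKernel κ p) (hp0 : 0 ≤ p) (x : Fin M → V) :
    prodExp (fun i => κ (x i))
      (fun y => (Fintype.card V : ℝ) - (occupiedSites (stepTo x y)).card) ≤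
      (Fintype.card V - (occupiedSites x).card) *
        (1 - p / Fintype.card V) ^ (unhappySet x).card + (crowdedSites x).card * p ^ 2 := by
  have hsum : ∀ y, (Fintype.card V : ℝ) - (occupiedSites (stepTo x y)).card =
      ∑ v, if v ∈ occupiedSites (stepTo x y) then (0 : ℝ) else 1 := by
    intro y
    rw [Finset.sum_ite, Finset.sum_const_zero, zero_add, Finset.sum_const, nsmul_eq_mul, mul_one,
      Finset.filter_notMem_eq_sdiff, ← Finset.compl_eq_univ_sdiff, Finset.card_compl,
      Nat.cast_sub (Finset.card_le_univ _)]
  rw [funext hsum, prodExp_sum]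
  calc _ ≤ ∑ v, ((if v ∈ (occupiedSites x)ᶜ then
            (1 - p / Fintype.card V) ^ (unhappySet x).card else 0) +
          if v ∈ crowdedSites x then p ^ 2 else 0) := by
        refine Finset.sum_le_sum fun v _ => ?_
        by_cases ho : v ∈ occupiedSites x
        · by_cases hc : v ∈ crowdedSites x
          · obtain ⟨i, j, hij, hi, hj⟩ := mem_crowdedSites.mp hc
            refine (prodExp_vacant_le hκ x {i, j} ?_ v).trans ?_
            · intro k hk
              rw [mem_unhappySet_iff]
              rcases Finset.mem_insert.mp hk with rfl | hk
              · rwa [hi]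
              · rw [Finset.mem_singleton.mp hk, hj]
                exact hc
            · rw [Finset.prod_pair hij, hi, hj]
              simp only [Finset.mem_compl, ho, not_true, if_false, hc, if_true, zero_add]
              have h1 := hκ.stay v
              have h2 := hκ.le_one v v
              nlinarith
          · simp only [Finset.mem_compl, ho, not_true, if_false, hc, add_zero]
            refine (prodExp_mono (G := fun _ => 0) (fun i => hκ.nonneg (x i)) fun y => ?_).trans
              (le_of_eq (prodExp_const (fun i => hκ.sum_eq_one (x i)) 0))
            obtain ⟨i, -, hi⟩ := Finset.mem_image.mp ho
            rw [if_pos]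
            refine Finset.mem_image.mpr ⟨i, Finset.mem_univ i, ?_⟩
            rw [stepTo_of_notMem, hi]
            rwa [mem_unhappySet_iff, hi]
        · have hc : v ∉ crowdedSites x := fun h => ho (crowdedSites_subset_occupiedSites x h)
          simp only [Finset.mem_compl, ho, not_false_eq_true, if_true, hc, if_false, add_zero]
          refine (prodExp_vacant_le hκ x _ subset_rfl v).trans ?_
          rw [← Finset.prod_const]
          refine Finset.prod_le_prod (fun i _ => sub_nonneg.mpr (hκ.le_one _ _)) fun i _ => ?_
          have : x i ≠ v := fun h => ho (Finset.mem_image.mpr ⟨i, Finset.mem_univ i, h⟩)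
          have := hκ.move _ _ this
          linarith
    _ = _ := by
        rw [Finset.sum_add_distrib, Finset.sum_ite_mem, Finset.sum_ite_mem, Finset.univ_inter,
          Finset.univ_inter, Finset.sum_const, Finset.sum_const, nsmul_eq_mul, nsmul_eq_mul,
          Finset.card_compl, Nat.cast_sub (Finset.card_le_univ _)]

/-- Here `w`, `S` and `k` count occupied vertices, crowded vertices and unhappy particles, and `m -
w` is the excess. A second-order expansion of `(1 - p / n) ^ k` suffices because the excess, being
`k - S ≥ k / 2`, dominates the quadratic term. -/
theorem excess_drift_bound {n m w S p α : ℝ} {k : ℕ} (hn : 1 ≤ n) (hp0 : 0 ≤ p) (hp1 : p ≤ 1)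
    (hα : 0 ≤ α) (hm : m = (1 - (p / 2 + α)) * n) (hw : 0 ≤ w) (hwn : w ≤ n) (hS : 0 ≤ S)
    (hx : m - w = k - S) (hSk : 2 * S ≤ k) :
    m - n + ((n - w) * (1 - p / n) ^ k + S * p ^ 2) ≤ (1 - p * α) * (m - w) := by
  obtain ⟨z, hz⟩ : ∃ z, z = p / n := ⟨_, rfl⟩
  rw [← hz]
  have hzn : z * n = p := by rw [hz]; field_simp
  have hz0 : 0 ≤ z := by rw [hz]; positivity
  have hz1 : z ≤ 1 := by
    rw [hz, div_le_one (by linarith)]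
    linarith
  have h3 := mul_le_mul_of_nonneg_left (one_sub_pow_le hz0 hz1 k) (sub_nonneg.mpr hwn)
  have hzE : z * (n - w) ≤ 1 := by nlinarith [mul_nonneg hz0 hw]
  have hk : (0 : ℝ) ≤ k := Nat.cast_nonneg _
  have hMw : 0 ≤ m - w := by linarith
  have h4 : (n - w) * (k * z) * (1 - z * (m - w)) ≤
      (n - w) * (k * z - k * (k - 1) / 2 * z ^ 2) := by
    have : 0 ≤ (n - w) * (k * z * z) * (m - w - (k - 1) / 2) :=
      mul_nonneg (mul_nonneg (by linarith) (by positivity)) (by linarith)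
    linarith
  -- The vacancies exceed `n * (p / 2 + α)` by exactly the excess, which covers the correction since
  -- `z * (n - w) ≤ 1`.
  have h5 : n * (p / 2 + α) ≤ (n - w) * (1 - z * (m - w)) := by
    have h := mul_nonneg hMw (sub_nonneg.mpr hzE)
    have hE : n - w = n * (p / 2 + α) + (m - w) := by rw [hm]; ring
    linarith
  have h6 : k * p * (p / 2 + α) ≤ (n - w) * (k * z) * (1 - z * (m - w)) :=
    calc k * p * (p / 2 + α) = k * z * (n * (p / 2 + α)) := by rw [← hzn]; ring
      _ ≤ k * z * ((n - w) * (1 - z * (m - w))) :=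
        mul_le_mul_of_nonneg_left h5 (mul_nonneg hk hz0)
      _ = _ := by ring
  -- `S ≤ k / 2` lets the `p / 2` term absorb `S * p ^ 2`.
  have h7 : p * α * (m - w) ≤ k * p * (p / 2 + α) - S * p ^ 2 := by
    rw [hx]
    have a1 := mul_nonneg (mul_nonneg hp0 hα) hS
    have a2 := mul_nonneg (sq_nonneg p) (sub_nonneg.mpr hSk)
    linarith
  linarith

/-- The number of particles in excess of the occupied vertices decreases in mean. -/
theorem prodExp_excess_le (hκ : IsLazyKernel κ p) (hp0 : 0 ≤ p) (hp1 : p ≤ 1) {α : ℝ}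
    (hα : 0 ≤ α) (hV : 0 < Fintype.card V)
    (hM : (M : ℝ) = (1 - (p / 2 + α)) * Fintype.card V) (x : Fin M → V) :
    prodExp (fun i => κ (x i)) (fun y => (M : ℝ) - (occupiedSites (stepTo x y)).card) ≤
      (1 - p * α) * (M - (occupiedSites x).card) := by
  have h1 := prodExp_card_vacant_le hκ hp0 x
  have e : prodExp (fun i => κ (x i)) (fun y => (M : ℝ) - (occupiedSites (stepTo x y)).card) =
      M - Fintype.card V + prodExp (fun i => κ (x i))
        (fun y => (Fintype.card V : ℝ) - (occupiedSites (stepTo x y)).card) := by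
    rw [← prodExp_const (q := fun i => κ (x i)) (fun i => hκ.sum_eq_one (x i))
      ((M : ℝ) - Fintype.card V), ← prodExp_add]
    congr 1
    funext y
    ring
  rw [e]
  have c1 : ((happySites x).card : ℝ) + (unhappySet x).card = M := by
    exact_mod_cast card_happySites_add x
  have c2 : ((happySites x).card : ℝ) + (crowdedSites x).card = (occupiedSites x).card := by
    exact_mod_cast card_happySites_add_crowdedSites x
  have c3 : 2 * ((crowdedSites x).card : ℝ) ≤ (unhappySet x).card := by
    exact_mod_cast two_mul_card_crowdedSites_le x
  have c4 : ((occupiedSites x).card : ℝ) ≤ Fintype.card V := by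
    exact_mod_cast Finset.card_le_univ _
  have hn : (1 : ℝ) ≤ Fintype.card V := by exact_mod_cast hV
  exact (add_le_add_right h1 _).trans (excess_drift_bound hn hp0 hp1 hα hM (Nat.cast_nonneg _) c4
    (Nat.cast_nonneg _) (by linarith) c3)

end Drift

/-! ### Exponential moments of the number of crowded vertices -/

section CrowdedBounds

variable {M : ℕ} {V : Type*} [Fintype V] [DecidableEq V] {κ : V → V → ℝ} {p : ℝ}

/-- With few unhappy particles, the exponential of the number of crowded sites is a
supermartingale. -/
theorem prodExp_pow_crowdedSites_le (hκ : IsLazyKernel κ p) (hp0 : 0 ≤ p) (hp1 : p ≤ 1) {α : ℝ}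
    (hα : 0 ≤ α) (hαp : α ≤ p / 2) (hV : 0 < Fintype.card V)
    (hM : (M : ℝ) = (1 - (p / 2 - α)) * Fintype.card V) (x : Fin M → V)
    (hU : 3 * ((unhappySet x).card : ℝ) ≤ α * Fintype.card V) :
    prodExp (fun i => κ (x i)) (fun y => (1 - α / 2) ^ (crowdedSites (stepTo x y)).card) ≤
      (1 - α / 2) ^ (crowdedSites x).card := by
  have hsum : ∀ i, ∑ w, κ (x i) w = 1 := fun i => hκ.sum_eq_one (x i)
  rcases (crowdedSites x).eq_empty_or_nonempty with hC | ⟨v₀, hv₀⟩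
  · simp [stepTo_of_crowdedSites_eq_empty hC, hC, prodExp_const hsum]
  obtain ⟨i₀, -⟩ := mem_crowdedSites.mp hv₀
  have : Nonempty (Fin M) := ⟨i₀⟩
  choose! f g hfg using fun v (hv : v ∈ crowdedSites x) => mem_crowdedSites.mp hv
  have hn : (1 : ℝ) ≤ Fintype.card V := by exact_mod_cast hV
  have hdisj : Disjoint (crowdedSites x) (happySites x) := Finset.disjoint_sdiff
  have hmove : ∀ v ∈ crowdedSites x, ∀ w ∈ happySites x, p / Fintype.card V ≤ κ v w :=
    fun v hv w hw => hκ.move v w fun e => Finset.disjoint_left.mp hdisj hv (e ▸ hw)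
  have c1 : ((happySites x).card : ℝ) + (unhappySet x).card = M := by
    exact_mod_cast card_happySites_add x
  have c3 : 2 * ((crowdedSites x).card : ℝ) ≤ (unhappySet x).card := by
    exact_mod_cast two_mul_card_crowdedSites_le x
  have hρ0 : 0 ≤ 1 - p / 2 + α / 3 := by linarith
  have hρ1 : 1 - p / 2 + α / 3 ≤ 1 := by linarith
  -- There are at least (1 - p/2 + α)n - αn/3 happy vertices, and twice the crowded ones number at
  -- most αn/3.
  have hρ : p * (1 - p / 2 + α / 3) ≤ p / Fintype.card V *
      ((happySites x).card - 2 * (crowdedSites x).card) :=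
    calc p * (1 - p / 2 + α / 3) =
          p / Fintype.card V * ((1 - p / 2 + α / 3) * Fintype.card V) := by field_simp
      _ ≤ _ := mul_le_mul_of_nonneg_left (by linarith) (by positivity)
  -- The main terms give (1 - p)² + 2p(1 - p/2 + α/3) = 1 + 2pα/3, while the left side is at most 1
  -- + pα/2.
  have hgain : ∀ v ∈ crowdedSites x, 1 + α / 2 * (p * (1 - p / 2 + α / 3)) ^ 2 ≤
      κ v v ^ 2 + 2 * (p * (1 - p / 2 + α / 3)) := by
    intro v _
    have h1 : (1 - p) ^ 2 ≤ κ v v ^ 2 :=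
      pow_le_pow_left₀ (by linarith) (hκ.stay v) 2
    have h2 : (p * (1 - p / 2 + α / 3)) ^ 2 ≤ p := by
      have h3 : p * (1 - p / 2 + α / 3) ≤ p := by nlinarith
      nlinarith [mul_nonneg hp0 hρ0]
    nlinarith [mul_le_mul_of_nonneg_left h2 hα, mul_nonneg hp0 hα]
  refine (prodExp_mono (fun i => hκ.nonneg (x i)) fun y => ?_).trans
    (prodExp_pow_pairs_le hκ.nonneg hκ.sum_eq_one (b := α / 2) (by linarith) (by linarith)
      (by positivity) x (crowdedSites x) (happySites x) hdisj f g
      hfg hmove hρ hgain)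
  refine pow_le_pow_of_le_one (by linarith) (by linarith) ?_
  rw [← Finset.card_union_of_disjoint]
  · refine Finset.card_le_card (Finset.union_subset ?_ ?_)
    · intro v hv
      obtain ⟨hvC, h1, h2⟩ := Finset.mem_filter.mp hv
      obtain ⟨h3, h4, h5⟩ := hfg v hvC
      exact mem_crowdedSites_stepTo_of_pair h3 (mem_unhappySet_iff.mpr (h4.symm ▸ hvC))
        (mem_unhappySet_iff.mpr (h5.symm ▸ hvC)) h1 h2
    · intro v hv
      obtain ⟨hvT, hv⟩ := Finset.mem_inter.mp hv
      rcases Finset.mem_union.mp hv with hv | hv <;> obtain ⟨w, hw, rfl⟩ := Finset.mem_image.mp hv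
      · exact mem_crowdedSites_stepTo_of_happy hvT
          (mem_unhappySet_iff.mpr ((hfg w hw).2.1.symm ▸ hw)) rfl
      · exact mem_crowdedSites_stepTo_of_happy hvT
          (mem_unhappySet_iff.mpr ((hfg w hw).2.2.symm ▸ hw)) rfl
  · exact Finset.disjoint_of_subset_left (Finset.filter_subset _ _)
      (Finset.disjoint_of_subset_right Finset.inter_subset_left hdisj)

/-- Happy vertices become crowded when hit. -/
theorem prodExp_pow_crowdedSites_le_of_happy (hκ : IsLazyKernel κ p) (hp0 : 0 ≤ p) {b : ℝ}
    (hb0 : 0 ≤ b) (hb1 : b ≤ 1) (x : Fin M → V) (s : Finset (Fin M)) (hs : s ⊆ unhappySet x) :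
    prodExp (fun i => κ (x i)) (fun y => (1 - b) ^ (crowdedSites (stepTo x y)).card) ≤
      Real.exp (-(b * (p / Fintype.card V) * s.card * ((happySites x).card - s.card))) := by
  have hsum : ∀ i, ∑ w, κ (x i) w = 1 := fun i => hκ.sum_eq_one (x i)
  rw [← prodExp_const hsum (Real.exp _)]
  refine (prodExp_mono (fun i => hκ.nonneg (x i)) fun y => ?_).trans
    (prodExp_pow_card_hits_le (fun i => hκ.nonneg (x i)) hsum hb0 hb1
      (by positivity) s (fun _ => happySites x) (fun _ _ _ _ => rfl) fun i hi _ v hv =>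
        hκ.move _ _ ?_)
  · refine pow_le_pow_of_le_one (by linarith) (by linarith) (Finset.card_le_card fun v hv => ?_)
    obtain ⟨hvT, hv⟩ := Finset.mem_inter.mp hv
    obtain ⟨i, hi, rfl⟩ := Finset.mem_image.mp hv
    exact mem_crowdedSites_stepTo_of_happy hvT (hs hi) rfl
  · rintro rfl
    exact (Finset.mem_sdiff.mp hv).2 (mem_unhappySet_iff.mp (hs hi))

/-- Empty vertices become crowded when hit by two disjoint groups of particles. -/
theorem prodExp_pow_crowdedSites_le_of_empty (hκ : IsLazyKernel κ p) (hp0 : 0 ≤ p) {b : ℝ}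
    (hb0 : 0 ≤ b) (hb1 : b ≤ 1) (x : Fin M → V) (s t : Finset (Fin M)) (hs : s ⊆ unhappySet x)
    (ht : t ⊆ unhappySet x) (hst : Disjoint s t) {θ : ℝ}
    (hθ : θ = b * (p / Fintype.card V) * t.card) :
    prodExp (fun i => κ (x i)) (fun y => (1 - b) ^ (crowdedSites (stepTo x y)).card) ≤
      Real.exp (θ * t.card - (1 - Real.exp (-θ)) * (p / Fintype.card V) * s.card *
        ((Fintype.card V - (occupiedSites x).card) - s.card)) := by
  have hsum : ∀ i, ∑ w, κ (x i) w = 1 := fun i => hκ.sum_eq_one (x i)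
  have hmove : ∀ i, ∀ v ∈ (occupiedSites x)ᶜ, p / Fintype.card V ≤ κ (x i) v := by
    intro i v hv
    refine hκ.move _ _ fun e => Finset.mem_compl.mp hv ?_
    exact Finset.mem_image.mpr ⟨i, Finset.mem_univ i, e⟩
  have hθ0 : 0 ≤ θ := by rw [hθ]; positivity
  have hexp : Real.exp (-θ) ≤ 1 := Real.exp_le_one_iff.mpr (by linarith)
  calc _ ≤ prodExp (fun i => κ (x i))
        (fun y => (1 - b) ^ (((occupiedSites x)ᶜ ∩ s.image y) ∩ t.image y).card) := by
        refine prodExp_mono (fun i => hκ.nonneg (x i)) fun y =>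
          pow_le_pow_of_le_one (by linarith) (by linarith) (Finset.card_le_card fun v hv => ?_)
        obtain ⟨hvs, hvt⟩ := Finset.mem_inter.mp hv
        obtain ⟨i, hi, hiv⟩ := Finset.mem_image.mp (Finset.mem_inter.mp hvs).2
        obtain ⟨j, hj, hjv⟩ := Finset.mem_image.mp hvt
        exact mem_crowdedSites_stepTo_of_pair
          (fun e : i = j => Finset.disjoint_left.mp hst hi (e ▸ hj)) (hs hi) (ht hj) hiv hjv
    _ ≤ prodExp (fun i => κ (x i)) (fun y => Real.exp (-(b * (p / Fintype.card V) * t.card *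
          ((((occupiedSites x)ᶜ ∩ s.image y).card : ℝ) - t.card)))) := by
        refine prodExp_pow_card_hits_le (fun i => hκ.nonneg (x i)) hsum hb0 hb1
          (by positivity) t (fun y => (occupiedSites x)ᶜ ∩ s.image y) (fun i hi y v => ?_)
          fun i _ y v hv => hmove i v (Finset.mem_inter.mp hv).1
        rw [image_update_of_notMem s y (Finset.disjoint_right.mp hst hi)]
    -- Read as a power with base `1 - (1 - exp (-θ))`, the exponential admits the hitting estimate
    -- again, now for `s`.
    _ = Real.exp (θ * t.card) * prodExp (fun i => κ (x i)) (fun y =>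
          (1 - (1 - Real.exp (-θ))) ^ ((occupiedSites x)ᶜ ∩ s.image y).card) := by
        rw [← prodExp_const_mul]
        congr 1
        funext y
        rw [sub_sub_cancel, ← Real.exp_nat_mul, ← Real.exp_add, ← hθ]
        congr 1
        ring
    _ ≤ Real.exp (θ * t.card) * prodExp (fun i => κ (x i)) (fun _ => Real.exp
          (-((1 - Real.exp (-θ)) * (p / Fintype.card V) * s.card *
            (((occupiedSites x)ᶜ.card : ℝ) - s.card)))) := by
        refine mul_le_mul_of_nonneg_left ?_ (Real.exp_pos _).le
        exact prodExp_pow_card_hits_le (fun i => hκ.nonneg (x i)) hsum (by linarith)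
          (by linarith [Real.exp_pos (-θ)]) (by positivity) s (fun _ => (occupiedSites x)ᶜ)
          (fun _ _ _ _ => rfl) fun i _ _ v hv => hmove i v hv
    _ = _ := by
        rw [prodExp_const hsum, ← Real.exp_add, Finset.card_compl,
          Nat.cast_sub (Finset.card_le_univ _)]
        ring_nf

theorem half_le_floor {a : ℝ} (ha : 1 ≤ a) : a / 2 ≤ ⌊a⌋₊ := by
  have h1 := Nat.lt_floor_add_one a
  have h2 : (1 : ℝ) ≤ ⌊a⌋₊ := by exact_mod_cast Nat.le_floor (by simpa using ha)
  linarith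

/-- With a positive fraction of unhappy particles, many vertices are crowded after a step. -/
theorem prodExp_pow_crowdedSites_le_of_many (hκ : IsLazyKernel κ p) (hp0 : 0 ≤ p) (hp1 : p ≤ 1)
    {b : ℝ} (hb0 : 0 ≤ b) (hb1 : b ≤ 1) (hM : M ≤ Fintype.card V)
    (hpn : 2048 ≤ p * Fintype.card V) (x : Fin M → V)
    (hU : (Fintype.card V : ℝ) / 4 ≤ (unhappySet x).card) :
    prodExp (fun i => κ (x i)) (fun y => (1 - b) ^ (crowdedSites (stepTo x y)).card) ≤
      Real.exp (-(b * p ^ 3 * Fintype.card V / 2 ^ 23)) := by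
  have hM' : (M : ℝ) ≤ Fintype.card V := by exact_mod_cast hM
  have c1 : ((happySites x).card : ℝ) + (unhappySet x).card = M := by
    exact_mod_cast card_happySites_add x
  have c2 : ((happySites x).card : ℝ) + (crowdedSites x).card = (occupiedSites x).card := by
    exact_mod_cast card_happySites_add_crowdedSites x
  have c3 : 2 * ((crowdedSites x).card : ℝ) ≤ (unhappySet x).card := by
    exact_mod_cast two_mul_card_crowdedSites_le x
  obtain ⟨n, hn⟩ : ∃ n : ℝ, n = Fintype.card V := ⟨_, rfl⟩
  rw [← hn] at hM' hpn hU ⊢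
  have hn0 : 0 ≤ n := hn ▸ Nat.cast_nonneg _
  have hn2 : 2048 ≤ n := by nlinarith
  -- The group sizes n/16 and pn/2048 make the gain at least θpn/1024 and the loss at most θpn/2048,
  -- half of it.
  have hJ1 := half_le_floor (a := n / 16) (by linarith)
  have hJ1' := Nat.floor_le (a := n / 16) (by linarith)
  have hJ2 := half_le_floor (a := p * n / 2048) (by linarith)
  have hJ2' := Nat.floor_le (a := p * n / 2048) (by linarith)
  have hsub : ⌊n / 16⌋₊ + ⌊p * n / 2048⌋₊ ≤ (unhappySet x).card := by
    have : ((⌊n / 16⌋₊ : ℝ) + ⌊p * n / 2048⌋₊) ≤ (unhappySet x).card := by nlinarith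
    exact_mod_cast this
  obtain ⟨s, hs, hscard⟩ := Finset.exists_subset_card_eq
    (show ⌊n / 16⌋₊ ≤ (unhappySet x).card by omega)
  obtain ⟨t, ht, htcard⟩ := Finset.exists_subset_card_eq
    (show ⌊p * n / 2048⌋₊ ≤ (unhappySet x \ s).card by
      rw [Finset.card_sdiff_of_subset hs, hscard]; omega)
  have hst : Disjoint s t := Finset.disjoint_of_subset_right ht Finset.disjoint_sdiff
  refine (prodExp_pow_crowdedSites_le_of_empty hκ hp0 hb0 hb1 x s t hs
    (ht.trans Finset.sdiff_subset) hst rfl).trans (Real.exp_le_exp.mpr ?_)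
  rw [hscard, htcard, ← hn]
  -- The occupied vertices number at most M minus half the unhappy particles.
  have hE : n / 8 ≤ n - (occupiedSites x).card := by linarith
  generalize ((occupiedSites x).card : ℝ) = w at hE
  generalize (⌊n / 16⌋₊ : ℝ) = J at hJ1 hJ1'
  generalize (⌊p * n / 2048⌋₊ : ℝ) = L at hJ2 hJ2'
  obtain ⟨z, hz⟩ : ∃ z, z = p / n := ⟨_, rfl⟩
  have hzn : z * n = p := by rw [hz]; field_simp
  have hz0 : 0 ≤ z := by rw [hz]; positivity
  rw [← hz]
  obtain ⟨θ, hθ⟩ : ∃ θ, θ = b * z * L := ⟨_, rfl⟩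
  rw [← hθ]
  have hL0 : 0 ≤ L := by linarith
  have hθ0 : 0 ≤ θ := by rw [hθ]; positivity
  have hzL : z * L ≤ p ^ 2 / 2048 := by
    have := mul_le_mul_of_nonneg_left hJ2' hz0
    have e : z * (p * n / 2048) = p ^ 2 / 2048 := by
      rw [show z * (p * n / 2048) = (z * n) * p / 2048 by ring, hzn]; ring
    linarith
  have hzL' : p ^ 2 / 4096 ≤ z * L := by
    have := mul_le_mul_of_nonneg_left hJ2 hz0
    have e : z * (p * n / 2048 / 2) = p ^ 2 / 4096 := by
      rw [show z * (p * n / 2048 / 2) = (z * n) * p / 4096 by ring, hzn]; ring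
    linarith
  have hθ1 : θ ≤ 1 := by
    have : z * L ≤ 1 := by nlinarith
    rw [hθ, mul_assoc]
    exact mul_le_one₀ hb1 (by positivity) this
  have hθlow : b * (p ^ 2 / 4096) ≤ θ := by
    rw [hθ, mul_assoc]
    exact mul_le_mul_of_nonneg_left hzL' hb0
  have hexp : θ / 2 ≤ 1 - Real.exp (-θ) := by
    have h1 := Real.add_one_le_exp θ
    have h2 : Real.exp (-θ) * Real.exp θ = 1 := by rw [← Real.exp_add]; simp
    have h3 := Real.exp_pos (-θ)
    nlinarith
  have hprod : p * n / 512 ≤ z * J * (n - w - J) := by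
    have h1 : (n / 16 / 2) * (n / 16) ≤ J * (n - w - J) :=
      mul_le_mul hJ1 (by linarith) (by linarith) (by linarith)
    have h2 := mul_le_mul_of_nonneg_left h1 hz0
    have e : z * (n / 16 / 2 * (n / 16)) = p * n / 512 := by
      rw [show z * (n / 16 / 2 * (n / 16)) = (z * n) * n / 512 by ring, hzn]
    linarith
  have hpn0 : 0 ≤ p * n / 512 := by positivity
  have h1 : θ / 2 * (p * n / 512) ≤ (1 - Real.exp (-θ)) * (z * J * (n - w - J)) :=
    mul_le_mul hexp hprod hpn0 (by linarith)
  have h2 : θ * L ≤ θ * (p * n / 2048) := mul_le_mul_of_nonneg_left hJ2' hθ0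
  have h3 : b * (p ^ 2 / 4096) * (p * n / 2048) ≤ θ * (p * n / 2048) :=
    mul_le_mul_of_nonneg_right hθlow (by positivity)
  have e3 : b * (p ^ 2 / 4096) * (p * n / 2048) = b * p ^ 3 * n / 2 ^ 23 := by ring
  linarith

/-- If a quarter of n particles are unhappy, enough vertices are vacant for collisions there.
Otherwise at least n/4 vertices are happy, and about αn/8 unhappy particles aiming at them suffice.
-/
theorem prodExp_pow_crowdedSites_le_of_unhappy (hκ : IsLazyKernel κ p) (hp0 : 0 ≤ p)
    (hp1 : p ≤ 1) {α : ℝ} (hα : 0 ≤ α) (hαp : α ≤ p / 2)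
    (hM : (M : ℝ) = (1 - (p / 2 - α)) * Fintype.card V)
    (hlarge : 2048 ≤ Fintype.card V * p ^ 2 * α ^ 3) (x : Fin M → V)
    (hU : α * Fintype.card V < 3 * ((unhappySet x).card : ℝ)) :
    prodExp (fun i => κ (x i)) (fun y => (1 - α / 2) ^ (crowdedSites (stepTo x y)).card) ≤
      Real.exp (-(Fintype.card V * p ^ 2 * α ^ 3 / 2 ^ 24)) := by
  have c1 : ((happySites x).card : ℝ) + (unhappySet x).card = M := by
    exact_mod_cast card_happySites_add x
  obtain ⟨n, hn⟩ : ∃ n : ℝ, n = Fintype.card V := ⟨_, rfl⟩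
  have hn0 : 0 ≤ n := hn ▸ Nat.cast_nonneg _
  have hα1 : α ≤ 1 := by linarith
  have hMn : M ≤ Fintype.card V := by
    have : (M : ℝ) ≤ Fintype.card V := by rw [hM, ← hn]; nlinarith
    exact_mod_cast this
  have hp2 : p ^ 2 ≤ 1 := pow_le_one₀ hp0 hp1
  have hpn : 2048 ≤ p * Fintype.card V := by
    refine hlarge.trans ?_
    rw [← hn]
    have : p * α ^ 3 ≤ 1 := mul_le_one₀ hp1 (by positivity) (pow_le_one₀ hα hα1)
    have := mul_le_mul_of_nonneg_left this (mul_nonneg hp0 hn0)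
    linarith
  have hαn : 2048 ≤ α * Fintype.card V := by
    refine hlarge.trans ?_
    rw [← hn]
    have : p ^ 2 * α ^ 2 ≤ 1 := mul_le_one₀ hp2 (by positivity) (pow_le_one₀ hα hα1)
    have := mul_le_mul_of_nonneg_left this (mul_nonneg hα hn0)
    linarith
  by_cases hmany : (Fintype.card V : ℝ) / 4 ≤ (unhappySet x).card
  · refine (prodExp_pow_crowdedSites_le_of_many hκ hp0 hp1 (b := α / 2) (by linarith)
      (by linarith) hMn hpn x hmany).trans (Real.exp_le_exp.mpr (neg_le_neg ?_))
    rw [← hn]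
    -- `α ≤ p / 2` gives `α ^ 2 ≤ p`, trading p³α for p²α³.
    have h1 : p ^ 2 * α * (α ^ 2) ≤ p ^ 2 * α * p :=
      mul_le_mul_of_nonneg_left (by nlinarith) (by positivity)
    have h2 := mul_le_mul_of_nonneg_left h1 hn0
    linarith
  · rw [← hn] at hM hU hmany hαn ⊢
    have hH : n / 4 ≤ (happySites x).card := by nlinarith
    have hJ := half_le_floor (a := α * n / 8) (by linarith)
    have hJ' := Nat.floor_le (a := α * n / 8) (by linarith)
    obtain ⟨s, hs, hscard⟩ := Finset.exists_subset_card_eq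
      (show ⌊α * n / 8⌋₊ ≤ (unhappySet x).card by
        have : (⌊α * n / 8⌋₊ : ℝ) ≤ (unhappySet x).card := by linarith
        exact_mod_cast this)
    refine (prodExp_pow_crowdedSites_le_of_happy hκ hp0 (b := α / 2) (by linarith) (by linarith)
      x s hs).trans (Real.exp_le_exp.mpr (neg_le_neg ?_))
    rw [hscard, ← hn]
    generalize (⌊α * n / 8⌋₊ : ℝ) = J at hJ hJ'
    generalize ((happySites x).card : ℝ) = H at hH
    have hnpos : 0 < n := by nlinarith
    have h1 : (α * n / 8 / 2) * (n / 8) ≤ J * (H - J) :=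
      mul_le_mul hJ (by nlinarith) (by linarith) (by linarith)
    have h2 := mul_le_mul_of_nonneg_left h1
      (show 0 ≤ α / 2 * (p / n) by positivity)
    have e : α / 2 * (p / n) * ((α * n / 8 / 2) * (n / 8)) = n * p * α ^ 2 / 256 := by
      field_simp
      ring
    have h3 : n * p * α ^ 2 * (p * α) ≤ n * p * α ^ 2 * 1 :=
      mul_le_mul_of_nonneg_left (mul_le_one₀ hp1 hα hα1) (by positivity)
    have h4 : 0 ≤ n * p ^ 2 * α ^ 3 := by positivity
    linarith

/-- If `i` and `j` are unhappy, the probability that no vertex is crowded after the step is at most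
the probability that they do not meet. -/
theorem prodExp_no_crowded_le (hκ : IsLazyKernel κ p) (x : Fin M → V) {i j : Fin M} (hij : i ≠ j)
    (hi : i ∈ unhappySet x) (hj : j ∈ unhappySet x) :
    prodExp (fun i => κ (x i)) (fun y => (1 - (1 : ℝ)) ^ (crowdedSites (stepTo x y)).card) ≤
      1 - ∑ w, κ (x i) w * κ (x j) w := by
  have hsum : ∀ i, ∑ w, κ (x i) w = 1 := fun i => hκ.sum_eq_one (x i)
  have hmeet : ∀ w, prodExp (fun i => κ (x i)) (fun y => ∏ k, if k ∈ ({i, j} : Finset (Fin M))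
      then (if y k = w then (1 : ℝ) else 0) else 1) = κ (x i) w * κ (x j) w := by
    intro w
    rw [prodExp_prod (q := fun i => κ (x i)) fun k u =>
      if k ∈ ({i, j} : Finset (Fin M)) then (if u = w then (1 : ℝ) else 0) else 1,
      ← Finset.prod_pair (f := fun k => κ (x k) w) hij,
      ← Finset.univ_inter {i, j}, ← Finset.prod_ite_mem]
    refine Finset.prod_congr rfl fun k _ => ?_
    simp only [Finset.univ_inter]
    split_ifs
    · simp
    · simp [hsum k]
  rw [← Finset.sum_congr rfl fun w _ => hmeet w, ← prodExp_sum, le_sub_iff_add_le, ← prodExp_add]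
  refine (prodExp_mono (G := fun _ => 1) (fun i => hκ.nonneg (x i)) fun y => ?_).trans
    (prodExp_const hsum 1).le
  have hp : ∀ w, (∏ k, if k ∈ ({i, j} : Finset (Fin M))
      then (if y k = w then (1 : ℝ) else 0) else 1) =
      (if y i = w then (1 : ℝ) else 0) * (if y j = w then (1 : ℝ) else 0) := by
    intro w
    rw [Finset.prod_ite_mem, Finset.univ_inter, Finset.prod_pair hij]
  rw [Finset.sum_congr rfl fun w _ => hp w]
  simp only [sub_self, ite_mul, one_mul, zero_mul, Finset.sum_ite_eq, Finset.mem_univ, if_true]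
  -- As `0 ^ 0 = 1`, the power with base 0 is the indicator that no vertex is crowded; it vanishes
  -- when `i` and `j` meet.
  split_ifs with h
  · have hm := mem_crowdedSites_stepTo_of_pair hij hi hj h.symm rfl
    rw [zero_pow (Finset.card_ne_zero_of_mem hm), zero_add]
  · rw [add_zero]
    exact pow_le_one₀ le_rfl zero_le_one

end CrowdedBounds

/-! ### The transition kernel of the process -/

section Kernel

variable {V : Type*} [Fintype V] [MeasurableSpace V] [MeasurableSingletonClass V]

/-- The probability that an unhappy particle at `v` goes to `w`. -/
noncomputable def moveKernel {V : Type*} [MeasurableSpace V] (nb : V → Set V) (p : I)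
    (v w : V) : ℝ := (moveLaw nb p v).real {w}

theorem inv_card_le_uniformOn_real {s : Set V} {w : V} (hw : w ∈ s) :
    1 / (Fintype.card V : ℝ) ≤ (uniformOn s).real {w} := by
  classical
  have h := uniformOn_apply_finset (s := s.toFinset) (t := {w})
  rw [Set.coe_toFinset, Finset.coe_singleton,
    Finset.inter_singleton_of_mem (Set.mem_toFinset.mpr hw), Finset.card_singleton] at h
  rw [measureReal_def, h, ENNReal.toReal_div]
  simp only [Nat.cast_one, ENNReal.toReal_one, ENNReal.toReal_natCast]
  have : 0 < s.toFinset.card := Finset.card_pos.mpr ⟨w, Set.mem_toFinset.mpr hw⟩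
  exact one_div_le_one_div_of_le (by exact_mod_cast this)
    (by exact_mod_cast Finset.card_le_univ _)

theorem moveKernel_eq (nb : V → Set V) [∀ v, Nonempty (nb v)] (p : I) (v w : V) :
    moveKernel nb p v w =
      p * (uniformOn (nb v)).real {w} + (1 - p) * (Measure.dirac v).real {w} := by
  have : IsProbabilityMeasure (uniformOn (nb v)) :=
    isProbabilityMeasure_uniformOn (Set.toFinite _) (Set.nonempty_coe_sort.mp inferInstance)
  rw [moveKernel, moveLaw, measureReal_add_apply, measureReal_nnreal_smul_apply,
    measureReal_nnreal_smul_apply]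
  rfl

theorem isLazyKernel_moveKernel (nb : V → Set V) [∀ v, Nonempty (nb v)] (p : I)
    (hnb : ∀ v w, v ≠ w → w ∈ nb v) : IsLazyKernel (moveKernel nb p) p where
  nonneg _ _ := measureReal_nonneg
  sum_eq_one v := by
    simp [moveKernel]
  stay v := by
    rw [moveKernel_eq]
    have h1 : (Measure.dirac v).real {v} = 1 := by simp [measureReal_def]
    rw [h1, mul_one]
    have := mul_nonneg p.2.1 (measureReal_nonneg (μ := uniformOn (nb v)) (s := {v}))
    linarith
  move v w h := by
    rw [moveKernel_eq]
    have h1 := mul_le_mul_of_nonneg_left (inv_card_le_uniformOn_real (hnb v w h)) p.2.1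
    have h2 := mul_nonneg (sub_nonneg.mpr p.2.2)
      (measureReal_nonneg (μ := Measure.dirac v) (s := {w}))
    rw [mul_one_div] at h1
    linarith

/-- A step reads only the entries `r i (x i)`, which are independent with laws `moveLaw nb p (x i)`.
-/
theorem integral_step [DecidableEq V] (nb : V → Set V) [∀ v, Nonempty (nb v)] (p : I) {M : ℕ}
    (x : Fin M → V) (F : (Fin M → V) → ℝ) :
    ∫ r, F (step x r) ∂(Measure.pi fun _ : Fin M => Measure.pi fun v : V => moveLaw nb p v) =
      prodExp (fun i => moveKernel nb p (x i)) (fun y => F (stepTo x y)) := by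
  have hmap : (Measure.pi fun _ : Fin M => Measure.pi fun v : V => moveLaw nb p v).map
      (fun r i => r i (x i)) = Measure.pi fun i => moveLaw nb p (x i) := by
    rw [Measure.pi_map_pi (f := fun i (g : V → V) => g (x i))
      fun i => (measurable_pi_apply (x i)).aemeasurable]
    congr 1
    funext i
    exact (measurePreserving_eval (fun v => moveLaw nb p v) (x i)).map_eq
  calc _ = ∫ r, (fun y => F (stepTo x y)) (fun i => r i (x i))
        ∂(Measure.pi fun _ : Fin M => Measure.pi fun v : V => moveLaw nb p v) := rfl
    _ = ∫ y, F (stepTo x y) ∂(Measure.pi fun i => moveLaw nb p (x i)) := by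
        rw [← hmap, integral_map Measurable.of_discrete.aemeasurable
          Measurable.of_discrete.aestronglyMeasurable]
    _ = _ := by
        rw [integral_fintype .of_finite]
        refine Finset.sum_congr rfl fun y _ => ?_
        rw [measureReal_def, Measure.pi_singleton, ENNReal.toReal_prod, smul_eq_mul]
        rfl

end Kernel

/-! ### Markov property and the dispersion event -/

section Trajectory

theorem position_congr {M : ℕ} {V : Type*} (o : V) {ω ω' : Moves M V} {t : ℕ}
    (h : ∀ s < t, ω s = ω' s) : position o ω t = position o ω' t := by
  induction t with
  | zero => rfl
  | succ t ih =>
    rw [position, position, ih fun s hs => h s (hs.trans t.lt_succ_self), h t t.lt_succ_self]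

variable {V : Type*} [Fintype V] [MeasurableSpace V] [MeasurableSingletonClass V]

theorem measurable_position {M : ℕ} (o : V) (t : ℕ) :
    Measurable fun ω : Moves M V => position o ω t := by
  induction t with
  | zero => exact measurable_const
  | succ t ih =>
    have h : Measurable fun a : (Fin M → V) × (Fin M → V → V) => step a.1 a.2 :=
      Measurable.of_discrete
    exact h.comp (ih.prodMk (measurable_pi_apply t))

variable (nb : V → Set V) [∀ v, Nonempty (nb v)] (p : I) {M : ℕ}

instance : IsProbabilityMeasure (movesLaw nb p M) := by
  unfold movesLaw
  infer_instance

theorem indepFun_position (o : V) (t : ℕ) :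
    IndepFun (fun ω : Moves M V => position o ω t) (fun ω => ω t) (movesLaw nb p M) := by
  have h : iIndepFun (fun (s : ℕ) (ω : Moves M V) => ω s) (movesLaw nb p M) :=
    iIndepFun_infinitePi (X := fun _ r => r) fun _ => measurable_id
  have h2 := h.indepFun_finset (Finset.range t) {t} (by simp) fun s => measurable_pi_apply s
  -- The position at time `t` depends on the moves before `t` only; the later ones are filled with
  -- an arbitrary value.
  have h3 := h2.comp
    (φ := fun r => position o
      (fun s => if hs : s ∈ Finset.range t then r ⟨s, hs⟩ else fun _ v => v) t)
    (ψ := fun r => r ⟨t, Finset.mem_singleton_self t⟩)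
    Measurable.of_discrete Measurable.of_discrete
  convert h3 using 1
  · funext ω
    refine position_congr o fun s hs => ?_
    simp [hs]
  · rfl

theorem integrable_position (o : V) (t : ℕ) (F : (Fin M → V) → ℝ) :
    Integrable (fun ω => F (position o ω t)) (movesLaw nb p M) := by
  have : IsProbabilityMeasure ((movesLaw nb p M).map fun ω => position o ω t) :=
    Measure.isProbabilityMeasure_map (measurable_position o t).aemeasurable
  exact Integrable.comp_measurable (g := F) .of_finite (measurable_position o t)

theorem integral_position_succ [DecidableEq V] (o : V) (t : ℕ) (F : (Fin M → V) → ℝ) :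
    ∫ ω, F (position o ω (t + 1)) ∂(movesLaw nb p M) =
      ∫ ω, prodExp (fun i => moveKernel nb p (position o ω t i))
        (fun y => F (stepTo (position o ω t) y)) ∂(movesLaw nb p M) := by
  have hpos := measurable_position (M := M) o t
  have : IsProbabilityMeasure ((movesLaw nb p M).map fun ω => position o ω t) :=
    Measure.isProbabilityMeasure_map hpos.aemeasurable
  have heval : (movesLaw nb p M).map (fun ω => ω t) =
      Measure.pi fun _ : Fin M => Measure.pi fun v : V => moveLaw nb p v :=
    Measure.infinitePi_map_eval _ t
  have hprod := (indepFun_iff_map_prod_eq_prod_map_map hpos.aemeasurable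
    (measurable_pi_apply t).aemeasurable).mp (indepFun_position nb p (M := M) o t)
  rw [heval] at hprod
  calc _ = ∫ ω, (fun a : (Fin M → V) × (Fin M → V → V) => F (step a.1 a.2))
        (position o ω t, ω t) ∂(movesLaw nb p M) := rfl
    _ = ∫ a : (Fin M → V) × (Fin M → V → V), F (step a.1 a.2)
        ∂(((movesLaw nb p M).map fun ω => position o ω t).prod
          (Measure.pi fun _ : Fin M => Measure.pi fun v : V => moveLaw nb p v)) := by
        rw [← hprod, integral_map (hpos.prodMk (measurable_pi_apply t)).aemeasurable
          Measurable.of_discrete.aestronglyMeasurable]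
    _ = ∫ x, ∫ r, F (step x r)
          ∂(Measure.pi fun _ : Fin M => Measure.pi fun v : V => moveLaw nb p v)
          ∂((movesLaw nb p M).map fun ω => position o ω t) := integral_prod _ .of_finite
    _ = _ := by
        simp only [integral_step]
        rw [integral_map hpos.aemeasurable Measurable.of_discrete.aestronglyMeasurable]

theorem crowdedSites_position_eq_empty_of_le {M : ℕ} {V : Type*} [Fintype V] [DecidableEq V]
    {o : V} {ω : Moves M V} {s t : ℕ} (hst : s ≤ t) (h : crowdedSites (position o ω s) = ∅) :
    crowdedSites (position o ω t) = ∅ := by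
  induction t, hst using Nat.le_induction with
  | base => exact h
  | succ t _ ih =>
    rw [position, step_eq_stepTo, stepTo_of_crowdedSites_eq_empty ih]
    exact ih

/-- Dispersed configurations are absorbing, so only the configuration at time `⌊s⌋₊` matters. -/
theorem dispersionTime_le_iff {M : ℕ} {V : Type*} [Fintype V] [DecidableEq V]
    {o : V} {ω : Moves M V} {s : ℝ} (hs : 0 ≤ s) :
    (∃ k : ℕ, dispersionTime o ω = k ∧ (k : ℝ) ≤ s) ↔
      crowdedSites (position o ω ⌊s⌋₊) = ∅ := by
  constructor
  · rintro ⟨k, hk, hks⟩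
    have h : dispersionTime o ω < ((k + 1 : ℕ) : ℕ∞) := by
      rw [hk]
      exact_mod_cast k.lt_succ_self
    simp only [dispersionTime, iInf_lt_iff] at h
    obtain ⟨t, ht, htk⟩ := h
    have htk' : t < k + 1 := by exact_mod_cast htk
    exact crowdedSites_position_eq_empty_of_le
      ((Nat.lt_succ_iff.mp htk').trans (Nat.le_floor hks)) (crowdedSites_eq_empty_iff.mpr ht)
  · intro h
    have hle : dispersionTime o ω ≤ (⌊s⌋₊ : ℕ∞) :=
      iInf₂_le _ (crowdedSites_eq_empty_iff.mp h)
    obtain ⟨k, hk⟩ := ENat.ne_top_iff_exists.mp (ne_top_of_le_ne_top (ENat.natCast_ne_top _) hle)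
    refine ⟨k, hk.symm, ?_⟩
    rw [← hk] at hle
    exact (Nat.cast_le.mpr (by exact_mod_cast hle)).trans (Nat.floor_le hs)

theorem probTimeLE_eq [DecidableEq V] (M : ℕ) (o : V) {s : ℝ} (hs : 0 ≤ s) :
    probTimeLE nb p M o s = ∫ ω, (if crowdedSites (position o ω ⌊s⌋₊) = ∅ then (1 : ℝ) else 0)
      ∂(movesLaw nb p M) := by
  have hset : {ω : Moves M V | ∃ k : ℕ, dispersionTime o ω = k ∧ (k : ℝ) ≤ s} =
      {ω | crowdedSites (position o ω ⌊s⌋₊) = ∅} := Set.ext fun ω => dispersionTime_le_iff hs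
  have hmeas : MeasurableSet {ω : Moves M V | crowdedSites (position o ω ⌊s⌋₊) = ∅} :=
    measurable_position o ⌊s⌋₊ (MeasurableSet.of_discrete (s := {x | crowdedSites x = ∅}))
  rw [probTimeLE, hset, ← integral_indicator_one hmeas]
  refine integral_congr_ae (Filter.Eventually.of_forall fun ω => ?_)
  simp [Set.indicator_apply]

end Trajectory

/-! ### Bounds on the dispersion time -/

section Bounds

variable {V : Type*} [Fintype V] [DecidableEq V] [MeasurableSpace V] [MeasurableSingletonClass V]
  (nb : V → Set V) [∀ v, Nonempty (nb v)] (p : I) {M : ℕ}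

theorem integral_excess_le (hnb : ∀ v w, v ≠ w → w ∈ nb v) {α : ℝ} (hα : 0 ≤ α)
    (hpα : (p : ℝ) * α ≤ 1)
    (hM : (M : ℝ) = (1 - ((p : ℝ) / 2 + α)) * Fintype.card V) (o : V) (t : ℕ) :
    ∫ ω, ((M : ℝ) - (occupiedSites (position o ω t)).card) ∂(movesLaw nb p M) ≤
      (1 - p * α) ^ t * M := by
  have hV : 0 < Fintype.card V := Fintype.card_pos_iff.mpr ⟨o⟩
  induction t with
  | zero =>
    simp only [position, integral_const, probReal_univ, one_smul, pow_zero, one_mul]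
    exact sub_le_self _ (Nat.cast_nonneg _)
  | succ t ih =>
    rw [integral_position_succ nb p o t fun x => (M : ℝ) - (occupiedSites x).card]
    calc _ ≤ ∫ ω, (1 - p * α) * ((M : ℝ) - (occupiedSites (position o ω t)).card)
          ∂(movesLaw nb p M) :=
          integral_mono (integrable_position nb p o t fun x =>
              prodExp (fun i => moveKernel nb p (x i))
                fun y => (M : ℝ) - (occupiedSites (stepTo x y)).card)
            (integrable_position nb p o t fun x =>
              (1 - p * α) * ((M : ℝ) - (occupiedSites x).card))
            fun ω => prodExp_excess_le (isLazyKernel_moveKernel nb p hnb) p.2.1 p.2.2 hα hV hM _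
      _ ≤ (1 - p * α) * ((1 - p * α) ^ t * M) := by
          rw [integral_const_mul]
          exact mul_le_mul_of_nonneg_left ih (sub_nonneg.mpr hpα)
      _ = _ := by ring

/-- Markov's inequality: the excess is at least 1 unless the particles are dispersed. -/
theorem one_sub_le_probTimeLE (hnb : ∀ v w, v ≠ w → w ∈ nb v) {α : ℝ} (hα : 0 ≤ α)
    (hpα : (p : ℝ) * α ≤ 1)
    (hM : (M : ℝ) = (1 - ((p : ℝ) / 2 + α)) * Fintype.card V) (o : V) {s : ℝ} (hs : 0 ≤ s) :
    1 - (1 - p * α) ^ ⌊s⌋₊ * M ≤ probTimeLE nb p M o s := by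
  rw [probTimeLE_eq nb p M o hs]
  have h1 := integral_excess_le nb p hnb hα hpα hM o ⌊s⌋₊
  have hint := integrable_position nb p (M := M) o ⌊s⌋₊ fun x => (M : ℝ) - (occupiedSites x).card
  have h2 : ∫ ω, (1 - ((M : ℝ) - (occupiedSites (position o ω ⌊s⌋₊)).card))
      ∂(movesLaw nb p M) ≤ ∫ ω, (if crowdedSites (position o ω ⌊s⌋₊) = ∅ then (1 : ℝ) else 0)
      ∂(movesLaw nb p M) := by
    refine integral_mono ((integrable_const 1).sub hint)
      (integrable_position nb p o ⌊s⌋₊ fun x => if crowdedSites x = ∅ then (1 : ℝ) else 0)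
      fun ω => ?_
    change 1 - ((M : ℝ) - (occupiedSites (position o ω ⌊s⌋₊)).card) ≤
      if crowdedSites (position o ω ⌊s⌋₊) = ∅ then (1 : ℝ) else 0
    generalize position o ω ⌊s⌋₊ = x
    split_ifs with h
    · have : ((occupiedSites x).card : ℝ) ≤ M := by exact_mod_cast card_occupiedSites_le x
      linarith
    · have a1 := card_happySites_add x
      have a2 := card_happySites_add_crowdedSites x
      have a3 := two_mul_card_crowdedSites_le x
      have a4 := Finset.card_pos.mpr (Finset.nonempty_iff_ne_empty.mpr h)
      have : ((occupiedSites x).card : ℝ) + 1 ≤ M := by exact_mod_cast (by omega)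
      linarith
  rw [integral_sub (integrable_const 1) hint] at h2
  simp only [integral_const, probReal_univ, one_smul] at h2
  linarith

theorem probTimeLE_le_integral_pow (o : V) {s b : ℝ} (hs : 0 ≤ s) (hb : b ≤ 1) :
    probTimeLE nb p M o s ≤ ∫ ω, (1 - b) ^ (crowdedSites (position o ω ⌊s⌋₊)).card
      ∂(movesLaw nb p M) := by
  rw [probTimeLE_eq nb p M o hs]
  refine integral_mono
    (integrable_position nb p o ⌊s⌋₊ fun x => if crowdedSites x = ∅ then (1 : ℝ) else 0)
    (integrable_position nb p o ⌊s⌋₊ fun x => (1 - b) ^ (crowdedSites x).card) fun ω => ?_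
  change (if crowdedSites (position o ω ⌊s⌋₊) = ∅ then (1 : ℝ) else 0) ≤
    (1 - b) ^ (crowdedSites (position o ω ⌊s⌋₊)).card
  split_ifs with h
  · simp [h]
  · exact pow_nonneg (by linarith) _

theorem unhappySet_const {M : ℕ} {V : Type*} [DecidableEq V] (hM : 2 ≤ M) (o : V) :
    unhappySet (fun _ : Fin M => o) = Finset.univ := by
  ext i
  have : Nontrivial (Fin M) := Fin.nontrivial_iff_two_le.mpr hM
  obtain ⟨j, hj⟩ := exists_ne i
  simp only [mem_unhappySet, Finset.mem_univ, iff_true]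
  exact ⟨j, hj, rfl⟩

/-- Each step either does not raise the mean or resets it below the exponential, so the sum of both
bounds always holds. The induction starts at time 1, since at time 0 a single vertex is crowded. -/
theorem integral_pow_crowdedSites_le (hnb : ∀ v w, v ≠ w → w ∈ nb v) {α : ℝ} (hα : 0 ≤ α)
    (hαp : α ≤ p / 2) (hM2 : 2 ≤ M)
    (hM : (M : ℝ) = (1 - ((p : ℝ) / 2 - α)) * Fintype.card V)
    (hlarge : 2048 ≤ Fintype.card V * (p : ℝ) ^ 2 * α ^ 3) (o : V) (t : ℕ) :
    ∫ ω, (1 - α / 2) ^ (crowdedSites (position o ω (t + 1))).card ∂(movesLaw nb p M) ≤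
      (t + 1) * Real.exp (-(Fintype.card V * (p : ℝ) ^ 2 * α ^ 3 / 2 ^ 24)) := by
  have hV : 0 < Fintype.card V := Fintype.card_pos_iff.mpr ⟨o⟩
  have hV' : (0 : ℝ) < Fintype.card V := by exact_mod_cast hV
  have hκ := isLazyKernel_moveKernel nb p hnb
  have hp1 : (p : ℝ) ≤ 1 := p.2.2
  induction t with
  | zero =>
    rw [integral_position_succ nb p o 0 fun x => (1 - α / 2) ^ (crowdedSites x).card]
    simp only [position, integral_const, probReal_univ, one_smul, Nat.cast_zero, zero_add, one_mul]
    refine prodExp_pow_crowdedSites_le_of_unhappy hκ p.2.1 p.2.2 hα hαp hM hlarge _ ?_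
    rw [unhappySet_const hM2, Finset.card_univ, Fintype.card_fin, hM]
    nlinarith
  | succ t ih =>
    rw [integral_position_succ nb p o (t + 1) fun x => (1 - α / 2) ^ (crowdedSites x).card]
    have hint := integrable_position nb p (M := M) o (t + 1)
      fun x => (1 - α / 2) ^ (crowdedSites x).card
    calc _ ≤ ∫ ω, ((1 - α / 2) ^ (crowdedSites (position o ω (t + 1))).card +
            Real.exp (-(Fintype.card V * (p : ℝ) ^ 2 * α ^ 3 / 2 ^ 24))) ∂(movesLaw nb p M) := by
          refine integral_mono (integrable_position nb p o (t + 1) fun x =>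
              prodExp (fun i => moveKernel nb p (x i))
                fun y => (1 - α / 2) ^ (crowdedSites (stepTo x y)).card)
            (hint.add (integrable_const _)) fun ω => ?_
          change prodExp (fun i => moveKernel nb p (position o ω (t + 1) i))
                (fun y => (1 - α / 2) ^ (crowdedSites (stepTo (position o ω (t + 1)) y)).card) ≤
            (1 - α / 2) ^ (crowdedSites (position o ω (t + 1))).card +
              Real.exp (-(Fintype.card V * (p : ℝ) ^ 2 * α ^ 3 / 2 ^ 24))
          generalize position o ω (t + 1) = x
          by_cases hU : 3 * ((unhappySet x).card : ℝ) ≤ α * Fintype.card V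
          · have := prodExp_pow_crowdedSites_le hκ p.2.1 p.2.2 hα hαp hV hM x hU
            linarith [Real.exp_pos (-(Fintype.card V * (p : ℝ) ^ 2 * α ^ 3 / 2 ^ 24))]
          · have := prodExp_pow_crowdedSites_le_of_unhappy hκ p.2.1 p.2.2 hα hαp hM hlarge x
              (not_le.mp hU)
            have h0 : 0 ≤ (1 - α / 2) ^ (crowdedSites x).card := pow_nonneg (by linarith) _
            linarith
      _ ≤ _ := by
          rw [integral_add hint (integrable_const _), integral_const, probReal_univ, one_smul]
          push_cast
          linarith

/-- Starting from at least half as many particles as vertices, the process does not disperse in one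
step with probability bounded away from zero. -/
theorem prodExp_no_crowded_start_le {V : Type*} [Fintype V] [DecidableEq V] {M : ℕ}
    {κ : V → V → ℝ} {p : ℝ} (hκ : IsLazyKernel κ p) (hp0 : 0 ≤ p) (hp1 : p ≤ 1) (hM2 : 2 ≤ M) (hMn : M ≤ Fintype.card V)
    (hMn' : (Fintype.card V : ℝ) / 2 ≤ M) (o : V) :
    prodExp (fun _ : Fin M => κ o) (fun y => (1 - (1 : ℝ)) ^
      (crowdedSites (stepTo (fun _ => o) y)).card) ≤ 1 - 1 / 2 ^ 26 := by
  have hV : 0 < Fintype.card V := by omega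
  have hV' : (0 : ℝ) < Fintype.card V := by exact_mod_cast hV
  have hU := unhappySet_const hM2 o
  have hpair : prodExp (fun _ : Fin M => κ o) (fun y => (1 - (1 : ℝ)) ^
      (crowdedSites (stepTo (fun _ => o) y)).card) ≤ 1 - ∑ w, κ o w * κ o w := by
    refine prodExp_no_crowded_le hκ (fun _ : Fin M => o) (i := ⟨0, by omega⟩) (j := ⟨1, by omega⟩)
      ?_ ?_ ?_
    · simp
    · simp [hU]
    · simp [hU]
  -- For p ≤ 1/2 two particles both stay with probability at least 1/4. For p > 1/2 and n ≤ 2²⁶ they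
  -- meet with probability at least 1/n by Cauchy–Schwarz. For larger n, p³n/2²³ ≥ 1 in the
  -- exponential bound.
  by_cases hp : p ≤ 1 / 2
  · refine hpair.trans ?_
    have h1 : κ o o * κ o o ≤ ∑ w, κ o w * κ o w :=
      Finset.single_le_sum (f := fun w => κ o w * κ o w)
        (fun w _ => mul_self_nonneg (κ o w)) (Finset.mem_univ o)
    have h2 := hκ.stay o
    norm_num
    nlinarith
  · push Not at hp
    by_cases hn : (Fintype.card V : ℝ) ≤ 2 ^ 26
    · refine hpair.trans ?_
      have h1 := sq_sum_le_card_mul_sum_sq (s := Finset.univ) (f := κ o)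
      rw [hκ.sum_eq_one, one_pow, Finset.card_univ] at h1
      simp only [pow_two] at h1
      have h2 : 0 ≤ ∑ w, κ o w * κ o w := Finset.sum_nonneg fun w _ => mul_self_nonneg (κ o w)
      have h3 := mul_le_mul_of_nonneg_right hn h2
      linarith
    · push Not at hn
      have hb := prodExp_pow_crowdedSites_le_of_many hκ hp0 hp1 (b := 1) zero_le_one le_rfl hMn
        (by nlinarith) (fun _ : Fin M => o) (by
          rw [hU, Finset.card_univ, Fintype.card_fin]
          linarith)
      have hp3 : (1 / 2 : ℝ) ^ 3 ≤ p ^ 3 := pow_le_pow_left₀ (by norm_num) hp.le 3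
      have h1 : (1 : ℝ) ≤ 1 * p ^ 3 * Fintype.card V / 2 ^ 23 := by
        have := mul_le_mul hp3 hn.le (by positivity) (by positivity)
        linarith
      have h2 := Real.exp_le_exp.mpr (neg_le_neg h1)
      have h3 := Real.exp_neg_one_lt_half
      exact (hb.trans h2).trans (h3.le.trans (by norm_num))

/-- If M > n, dispersion is impossible; otherwise `α ≤ p / 2`. The constant 2⁻⁴⁰ is small enough
both to beat exp(-u/2²⁴) when u ≥ 2048 and to keep the time horizon at one step when u < 2048. -/
theorem probTimeLE_lt (hnb : ∀ v w, v ≠ w → w ∈ nb v) (hp : 0 < p) {α : ℝ} (hα : 0 < α)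
    (hV : 2 ≤ Fintype.card V) (hM : (M : ℝ) = (1 - ((p : ℝ) / 2 - α)) * Fintype.card V) (o : V) :
    probTimeLE nb p M o (Real.exp (1 / 2 ^ 40 * Fintype.card V * (p : ℝ) ^ 2 * α ^ 3)) <
      Real.exp (-(1 / 2 ^ 40 * Fintype.card V * (p : ℝ) ^ 2 * α ^ 3)) := by
  have hV' : (2 : ℝ) ≤ Fintype.card V := by exact_mod_cast hV
  have hp0 : (0 : ℝ) < p := hp
  have hp1 : (p : ℝ) ≤ 1 := p.2.2
  have hκ := isLazyKernel_moveKernel nb p hnb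
  obtain ⟨u, hu⟩ : ∃ u, u = Fintype.card V * (p : ℝ) ^ 2 * α ^ 3 := ⟨_, rfl⟩
  have hu0 : 0 < u := by rw [hu]; positivity
  have e : 1 / 2 ^ 40 * Fintype.card V * (p : ℝ) ^ 2 * α ^ 3 = u / 2 ^ 40 := by rw [hu]; ring
  rw [e]
  have hMn' : (Fintype.card V : ℝ) / 2 < M := by rw [hM]; nlinarith
  have hM2 : 2 ≤ M := by
    have : (1 : ℝ) < M := by linarith
    exact_mod_cast this
  by_cases hMn : M ≤ Fintype.card V
  · have hαp : α ≤ p / 2 := by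
      have : (M : ℝ) ≤ Fintype.card V := by exact_mod_cast hMn
      rw [hM] at this
      nlinarith
    have hk1 : 1 ≤ ⌊Real.exp (u / 2 ^ 40)⌋₊ :=
      Nat.le_floor (by simpa using Real.one_le_exp (by positivity))
    by_cases hlarge : 2048 ≤ u
    · refine (probTimeLE_le_integral_pow nb p o (b := α / 2) (Real.exp_pos _).le
        (by linarith)).trans_lt ?_
      obtain ⟨t, ht⟩ : ∃ t, ⌊Real.exp (u / 2 ^ 40)⌋₊ = t + 1 := ⟨_, (Nat.sub_add_cancel hk1).symm⟩
      have hfl := Nat.floor_le (Real.exp_pos (u / 2 ^ 40)).le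
      rw [ht] at hfl ⊢
      push_cast at hfl
      have hmain := integral_pow_crowdedSites_le nb p hnb hα.le hαp hM2 hM (hu ▸ hlarge) o t
      rw [← hu] at hmain
      calc _ ≤ ((t : ℝ) + 1) * Real.exp (-(u / 2 ^ 24)) := hmain
        _ ≤ Real.exp (u / 2 ^ 40) * Real.exp (-(u / 2 ^ 24)) :=
          mul_le_mul_of_nonneg_right hfl (Real.exp_pos _).le
        _ < _ := by
          rw [← Real.exp_add, Real.exp_lt_exp]
          linarith
    · push Not at hlarge
      have hsmall : u / 2 ^ 40 < 1 / 2 ^ 29 := by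
        rw [div_lt_div_iff₀ (by positivity) (by positivity)]
        linarith
      have hk : ⌊Real.exp (u / 2 ^ 40)⌋₊ = 1 := by
        rw [Nat.floor_eq_iff (Real.exp_pos _).le]
        constructor
        · simpa using Real.one_le_exp (by positivity)
        · have : Real.exp (u / 2 ^ 40) < 2 := by
            rw [← Real.lt_log_iff_exp_lt two_pos]
            have := Real.log_two_gt_d9
            norm_num at this hsmall ⊢
            linarith
          norm_num at this ⊢
          linarith
      refine (probTimeLE_le_integral_pow nb p o (b := 1) (Real.exp_pos _).le le_rfl).trans_lt ?_
      rw [hk, integral_position_succ nb p o 0 fun x => (1 - (1 : ℝ)) ^ (crowdedSites x).card]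
      simp only [position, integral_const, probReal_univ, one_smul]
      refine (prodExp_no_crowded_start_le hκ p.2.1 p.2.2 hM2 hMn hMn'.le o).trans_lt ?_
      -- exp(-u/2⁴⁰) ≥ 1 - u/2⁴⁰ > 1 - 2⁻²⁹, which exceeds 1 - 2⁻²⁶.
      have := Real.add_one_le_exp (-(u / 2 ^ 40))
      norm_num at this hsmall ⊢
      linarith
  · push Not at hMn
    rw [probTimeLE_eq nb p M o (Real.exp_pos _).le]
    refine lt_of_le_of_lt (le_of_eq ?_) (Real.exp_pos _)
    refine integral_eq_zero_of_ae (Filter.Eventually.of_forall fun ω => ?_)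
    obtain ⟨i, j, hij, h⟩ := Fintype.exists_ne_map_eq_of_card_lt
      (position o ω ⌊Real.exp (u / 2 ^ 40)⌋₊) (by simpa using hMn)
    change (if _ then (1 : ℝ) else 0) = 0
    rw [if_neg]
    exact Finset.ne_empty_of_mem (mem_crowdedSites.mpr ⟨i, j, hij, rfl, h.symm⟩)

end Bounds

theorem mem_completeNbhd {n : ℕ} (loops : Bool) (v w : Fin n) (h : v ≠ w) :
    w ∈ completeNbhd n loops v := by
  cases loops <;> simp [completeNbhd, h.symm]

end LazyDispersion

theorem theorem2 :
    (∃ C : ℝ, 0 < C ∧ ∃ K : ℝ, 0 < K ∧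
      ∀ (loops : Bool) (n : ℕ) [n.AtLeastTwo] (p : unitInterval) (α δ : ℝ) (M : ℕ) (o : Fin n),
        0 < p → 0 < α → δ = (p : ℝ) / 2 + α → (M : ℝ) = (1 - δ) * n →
        1 - K / n ≤ LazyDispersion.probTimeLE (LazyDispersion.completeNbhd n loops) p M o
          (C * (((p : ℝ) * α)⁻¹ * Real.log n))) ∧
    (∃ c : ℝ, 0 < c ∧
      ∀ (loops : Bool) (n : ℕ) [n.AtLeastTwo] (p : unitInterval) (α δ : ℝ) (M : ℕ) (o : Fin n),
        0 < p → 0 < α → δ = (p : ℝ) / 2 - α → (M : ℝ) = (1 - δ) * n →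
        LazyDispersion.probTimeLE (LazyDispersion.completeNbhd n loops) p M o
          (Real.exp (c * n * (p : ℝ) ^ 2 * α ^ 3)) <
        Real.exp (-(c * n * (p : ℝ) ^ 2 * α ^ 3))) := by
  refine ⟨⟨2, two_pos, Real.exp 1, Real.exp_pos 1, ?_⟩, 1 / 2 ^ 40, by positivity, ?_⟩
  · rintro loops n _ p α δ M o hp hα rfl hM
    have hn : 2 ≤ n := Nat.AtLeastTwo.prop
    have hn' : (2 : ℝ) ≤ n := by exact_mod_cast hn
    have hp0 : (0 : ℝ) < p := hp
    have hp1 : (p : ℝ) ≤ 1 := p.2.2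
    have hM0 : (0 : ℝ) ≤ M := Nat.cast_nonneg M
    have hMn : (M : ℝ) ≤ n := by rw [hM]; nlinarith
    have hα1 : α ≤ 1 := by
      rw [hM] at hM0
      nlinarith [nonneg_of_mul_nonneg_left hM0 (by linarith)]
    have hpα : (p : ℝ) * α ≤ 1 := mul_le_one₀ hp1 hα.le hα1
    have hpα0 : 0 < (p : ℝ) * α := mul_pos hp0 hα
    have hlog : 0 ≤ Real.log n := Real.log_nonneg (by linarith)
    have hs : 0 ≤ 2 * (((p : ℝ) * α)⁻¹ * Real.log n) := by positivity
    refine le_trans ?_ (LazyDispersion.one_sub_le_probTimeLE _ p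
      (fun v w => LazyDispersion.mem_completeNbhd loops v w) hα.le hpα
      (by simpa using hM) o hs)
    have hfl := Nat.lt_floor_add_one (2 * (((p : ℝ) * α)⁻¹ * Real.log n))
    generalize ⌊2 * (((p : ℝ) * α)⁻¹ * Real.log n)⌋₊ = k at hfl
    -- Rounding the time down costs at most `p * α ≤ 1` in the exponent; hence the factor e in K. C
    -- = 2 gives n⁻², of which one power is spent on M ≤ n.
    have hk : 2 * Real.log n - 1 ≤ k * (p * α) := by
      have h1 := mul_le_mul_of_nonneg_right hfl.le hpα0.le
      have h2 : 2 * (((p : ℝ) * α)⁻¹ * Real.log n) * (p * α) = 2 * Real.log n := by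
        field_simp
      nlinarith
    have hpow : (1 - (p : ℝ) * α) ^ k ≤ Real.exp 1 / (n * n) :=
      calc (1 - (p : ℝ) * α) ^ k ≤ Real.exp (-(p * α)) ^ k :=
            pow_le_pow_left₀ (by linarith) (Real.one_sub_le_exp_neg _) k
        _ = Real.exp (-(k * (p * α))) := by
            rw [← Real.exp_nat_mul]
            ring_nf
        _ ≤ Real.exp (1 - (Real.log n + Real.log n)) := Real.exp_le_exp.mpr (by linarith)
        _ = Real.exp 1 / (n * n) := by
            rw [Real.exp_sub, Real.exp_add, Real.exp_log (by linarith)]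
    have hfin : (1 - (p : ℝ) * α) ^ k * M ≤ Real.exp 1 / n :=
      calc _ ≤ Real.exp 1 / (n * n) * n :=
            mul_le_mul hpow hMn hM0 (by positivity)
        _ = _ := by field_simp
    linarith
  · rintro loops n _ p α δ M o hp hα rfl hM
    have hn : 2 ≤ n := Nat.AtLeastTwo.prop
    have h := LazyDispersion.probTimeLE_lt (LazyDispersion.completeNbhd n loops) p
      (fun v w => LazyDispersion.mem_completeNbhd loops v w) hp hα (by simpa using hn)
      (by simpa using hM) o
    simpa only [Fintype.card_fin] using h
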